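/- Work over $\mathbb C$. Let $\Lambda=\mathbb C[\mathbf p_1,\mathbf p_2,\dots]$ be the algebra of symmetric functions, with complete homogeneous functions $h_k$ given by $1+\sum_{k\ge1}h_kt^k=\exp\bigl(\sum_{k\ge1}\mathbf p_kt^k/k\bigr)$ ($h_0=1$, $h_k=0$ for $k<0$), $H(u)=1+\sum_{k\ge1}h_ku^{-k}$, and Schur functions $s_\mu=\det[h_{\mu_i-i+j}]$ (of order $\ell(\mu)$), indexed by Young diagrams $\mu$. Let $\Lambda^*=\varprojlim\Lambda^*_n$ (limit of filtered algebras, along $x_n=0$) be the algebra of shifted symmetric functions, where $\Lambda^*_n\subset\mathbb C[x_1,\dots,x_n]$ consists of the polynomials symmetric in the variables $x_j-j$. With $x^{\downarrow m}=x(x-1)\cdots(x-m+1)$, the shifted Schur function $s^*_\mu\in\Lambda^*$ is the unique element with $$s^*_\mu(x_1,\dots,x_n)=\frac{\det[(x_i+n-i)^{\downarrow(\mu_j+n-j)}]_{i,j=1}^n}{\det[(x_i+n-i)^{\downarrow(n-j)}]_{i,j=1}^n}\qquad(n\ge\ell(\mu)).$$ Put $h^*_k=s^*_{(k)}$ and $H^*(u)=1+\sum_{k\ge1}h^*_k/u^{\downarrow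 k}$, and let $\varphi:\Lambda^*\to\Lambda$ be the unique algebra isomorphism with $\varphi(H^*(u))=H(u+\tfrac12)$, an identity of formal series in $u^{-1}$. (That $s^*_\mu$ and $\varphi$ exist and are unique is part of the claim.) The Frobenius–Schur function is $Fs_\mu=\varphi(s^*_\mu)$. **Theorem 2.6.** For every Young diagram $\mu$, $$Fs_\mu=\sum_\nu c_{\mu\nu}\,s_\nu,$$ summed over the diagrams $\nu$ contained in $\mu$ and having the same number $d$ of diagonal squares as $\mu$. Here, writing $p_i=\mu_i-i$, $q_i=\mu'_i-i$, $p'_i=\nu_i-i$, $q'_i=\nu'_i-i$ ($1\le i\le d$; $\mu',\nu'$ are the transposed diagrams) for the Frobenius coordinates of $\mu$ and $\nu$, $$c_{\mu\nu}=\det[c_{p_i,p'_j}]_{i,j=1}^d\,\det[c_{q_i,q'_j}]_{i,j=1}^d,$$ where, for $p,p'=0,1,2,\dots$, $c_{pp'}=(-1)^{p-p'}e_{p-p'}\bigl(\tfrac12,\tfrac32,\dots,\tfrac{2p-1}2\bigr)$ if $p'\le p$ and $c_{pp'}=0$ if $p'>p$, with $e_k$ the elementary symmetric polynomials. -/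

import Mathlib

namespace FrobeniusSchur

/-! ### The algebra of symmetric functions -/

/-- The algebra of symmetric functions over `ℂ`, as the polynomial algebra `ℂ[𝐩₁, 𝐩₂, …]`;
the variable `X k` is the power sum `𝐩ₖ`, `k ≥ 1`. -/
abbrev Lam : Type := MvPolynomial ℕ+ ℂ

/-- The formal series `∑_{k ≥ 1} 𝐩ₖ tᵏ / k`. -/
noncomputable def powerSumSeries : PowerSeries Lam :=
  PowerSeries.mk fun k =>
    if hk : 0 < k then MvPolynomial.C (1 / (k : ℂ)) * MvPolynomial.X (⟨k, hk⟩ : ℕ+) else 0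

/-- The generating series `1 + ∑_{k ≥ 1} hₖ tᵏ = exp (∑_{k ≥ 1} 𝐩ₖ tᵏ / k)` of the complete
homogeneous symmetric functions. -/
noncomputable def hSeries : PowerSeries Lam :=
  (PowerSeries.exp ℚ).subst powerSumSeries

/-- The complete homogeneous symmetric function `hₖ`, with `hₖ = 0` for `k < 0`. -/
noncomputable def h (k : ℤ) : Lam :=
  if 0 ≤ k then PowerSeries.coeff k.toNat hSeries else 0

/-- The Schur function `s_μ = det [h_{μᵢ - i + j}]`, the order of the determinant being the number
`μ.colLen 0` of nonzero rows of `μ`. -/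
noncomputable def schur (μ : YoungDiagram) : Lam :=
  Matrix.det (Matrix.of fun i j : Fin (μ.colLen 0) =>
    h ((μ.rowLen i : ℤ) - ((i : ℕ) : ℤ) + ((j : ℕ) : ℤ)))

/-! ### The algebra of shifted symmetric functions -/

/-- The polynomials in `x₁, …, xₙ` that are symmetric in the shifted variables `x'ⱼ = xⱼ - j`,
i.e. of the form `g (x₁ - 1, …, xₙ - n)` with `g` symmetric. The variable `xⱼ` is `X (j - 1)`. -/
noncomputable def shiftedSymmetric (n : ℕ) : Subalgebra ℂ (MvPolynomial (Fin n) ℂ) :=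
  (MvPolynomial.symmetricSubalgebra (Fin n) ℂ).map
    (MvPolynomial.aeval fun j : Fin n =>
      (MvPolynomial.X j - MvPolynomial.C (((j : ℕ) : ℂ) + 1) : MvPolynomial (Fin n) ℂ))

/-- The specialization `x_{n+1} = 0`. -/
noncomputable def specializeLast (n : ℕ) :
    MvPolynomial (Fin (n + 1)) ℂ →ₐ[ℂ] MvPolynomial (Fin n) ℂ :=
  MvPolynomial.aeval
    (Fin.snoc (α := fun _ => MvPolynomial (Fin n) ℂ) (fun j : Fin n => MvPolynomial.X j) 0)

/-- The algebra `Λ*` of shifted symmetric functions: the projective limit, in the category of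
filtered algebras, of the algebras `shiftedSymmetric n` along the specializations `x_{n+1} = 0`.
An element is a compatible family of polynomials of bounded degree. -/
noncomputable def LamStar : Subalgebra ℂ ((n : ℕ) → MvPolynomial (Fin n) ℂ) where
  carrier := {f | (∀ n, f n ∈ shiftedSymmetric n) ∧ (∀ n, specializeLast n (f (n + 1)) = f n) ∧
    ∃ d : ℕ, ∀ n, (f n).totalDegree ≤ d}
  mul_mem' := by
    rintro f g ⟨hf, hf', a, ha⟩ ⟨hg, hg', b, hb⟩
    refine ⟨fun n => mul_mem (hf n) (hg n), fun n => ?_, a + b, fun n => ?_⟩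
    · simp [hf' n, hg' n]
    · exact (MvPolynomial.totalDegree_mul _ _).trans (Nat.add_le_add (ha n) (hb n))
  add_mem' := by
    rintro f g ⟨hf, hf', a, ha⟩ ⟨hg, hg', b, hb⟩
    refine ⟨fun n => add_mem (hf n) (hg n), fun n => ?_, max a b, fun n => ?_⟩
    · simp [hf' n, hg' n]
    · exact (MvPolynomial.totalDegree_add _ _).trans (max_le_max (ha n) (hb n))
  algebraMap_mem' := by
    intro c
    refine ⟨fun n => (shiftedSymmetric n).algebraMap_mem c, fun n => ?_, 0, fun n => ?_⟩
    · rw [Pi.algebraMap_apply, Pi.algebraMap_apply]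
      exact (specializeLast n).commutes c
    · rw [Pi.algebraMap_apply, MvPolynomial.algebraMap_eq, MvPolynomial.totalDegree_C]

/-- The falling factorial power `x (x - 1) ⋯ (x - m + 1)`. -/
def fallingPow {R : Type*} [CommRing R] (x : R) (m : ℕ) : R :=
  ∏ k ∈ Finset.range m, (x - (k : R))

/-- The determinant `det [(xᵢ + n - i)^{↓(aⱼ + n - j)}]`, `1 ≤ i, j ≤ n`, of falling factorial
powers. As `Fin n` counts from `0`, `n - i` becomes `n - 1 - i`. -/
noncomputable def fallingDet (n : ℕ) (a : Fin n → ℕ) : MvPolynomial (Fin n) ℂ :=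
  Matrix.det (Matrix.of fun i j : Fin n =>
    fallingPow (MvPolynomial.X i + MvPolynomial.C (((n - 1 - (i : ℕ) : ℕ) : ℂ)))
      (a j + (n - 1 - (j : ℕ))))

/-- `f` is the shifted Schur function `s*_μ`: for all `n ≥ ℓ(μ)`,
`f (x₁, …, xₙ) = det [(xᵢ + n - i)^{↓(μⱼ + n - j)}] / det [(xᵢ + n - i)^{↓(n - j)}]`.
The denominator is the nonzero polynomial `∏_{i<j} (xᵢ - xⱼ - i + j)`, and the components of `f`
for `n < ℓ(μ)` are obtained from the others by specialization. -/
def IsShiftedSchur (μ : YoungDiagram) (f : LamStar) : Prop :=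
  ∀ n : ℕ, μ.colLen 0 ≤ n →
    (f : (n : ℕ) → MvPolynomial (Fin n) ℂ) n * fallingDet n (fun _ => 0) =
      fallingDet n (fun j => μ.rowLen j)

/-- The shifted Schur function `s*_μ ∈ Λ*`. -/
noncomputable def shiftedSchur (μ : YoungDiagram) : LamStar :=
  Classical.epsilon (IsShiftedSchur μ)

/-- The one-row diagram `(k)`. -/
def rowDiagram (k : ℕ) : YoungDiagram :=
  YoungDiagram.ofRowLens [k] (List.sortedGE_iff_pairwise.2 (List.pairwise_singleton _ k))

/-- `h*_k = s*_{(k)}`. -/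
noncomputable def hStar (k : ℕ) : LamStar := shiftedSchur (rowDiagram k)

/-! ### The isomorphism `φ : Λ* → Λ` and the Frobenius–Schur functions

Formal series in `1/u` are power series in `t = 1/u`. -/

/-- The series `∑_{k ≥ 0} cₖ gₖ(t)`, for coefficients `cₖ` in a `ℂ`-algebra and series
`gₖ ∈ tᵏ ℂ[[t]]` (so that only `k ≤ n` contribute to the coefficient of `tⁿ`). -/
noncomputable def expandSeries {A : Type*} [CommRing A] [Algebra ℂ A]
    (g : ℕ → PowerSeries ℂ) (c : ℕ → A) : PowerSeries A :=
  PowerSeries.mk fun n => ∑ k ∈ Finset.range (n + 1), PowerSeries.coeff n (g k) • c k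

/-- `1 / (u (u - 1) ⋯ (u - k + 1))` as a series in `t = 1/u`: since `1/(u - i) = t (1 - i t)⁻¹`,
this is `∏_{i<k} t (1 - i t)⁻¹`. -/
noncomputable def invFallingPow (k : ℕ) : PowerSeries ℂ :=
  ∏ i ∈ Finset.range k, (PowerSeries.X * (1 - PowerSeries.C (i : ℂ) * PowerSeries.X)⁻¹)

/-- `1 / (u + 1/2)ᵏ` as a series in `t = 1/u`, that is `(t (1 + t/2)⁻¹)ᵏ`. -/
noncomputable def invHalfShiftPow (k : ℕ) : PowerSeries ℂ :=
  (PowerSeries.X * (1 + PowerSeries.C (1 / 2 : ℂ) * PowerSeries.X)⁻¹) ^ k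

/-- `H*(u) = 1 + ∑_{k ≥ 1} h*_k / (u (u - 1) ⋯ (u - k + 1))`; the term `k = 0` is
`h*_0 = s*_∅ = 1`. -/
noncomputable def HStar : PowerSeries LamStar := expandSeries invFallingPow hStar

/-- `H(u + 1/2) = 1 + ∑_{k ≥ 1} hₖ / (u + 1/2)ᵏ`. -/
noncomputable def HHalfShift : PowerSeries Lam := expandSeries invHalfShiftPow fun k => h k

/-- `φ : Λ* → Λ` is an isomorphism of algebras with `φ(H*(u)) = H(u + 1/2)`. -/
def IsPhi (φ : LamStar →ₐ[ℂ] Lam) : Prop :=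
  Function.Bijective φ ∧ PowerSeries.map (φ : LamStar →+* Lam) HStar = HHalfShift

instance : Nonempty (LamStar →ₐ[ℂ] Lam) :=
  ⟨((MvPolynomial.aeval Fin.elim0 : MvPolynomial (Fin 0) ℂ →ₐ[ℂ] Lam).comp
    (Pi.evalAlgHom ℂ (fun n : ℕ => MvPolynomial (Fin n) ℂ) 0)).comp LamStar.val⟩

/-- The isomorphism `φ : Λ* → Λ` determined by `φ(H*(u)) = H(u + 1/2)`. -/
noncomputable def phi : LamStar →ₐ[ℂ] Lam := Classical.epsilon IsPhi

/-- The Frobenius–Schur function `Fs_μ = φ(s*_μ)`. -/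
noncomputable def Fs (μ : YoungDiagram) : Lam := phi (shiftedSchur μ)

/-! ### Frobenius coordinates and transition coefficients -/

/-- The number `d(μ)` of diagonal squares. -/
def depth (μ : YoungDiagram) : ℕ := (μ.cells.filter fun c => c.1 = c.2).card

/-- The Frobenius coordinate `μᵢ - i`; here rows are counted from `0`, and only rows
`i < depth μ` are used, for which the subtraction is not truncated. -/
def frobP (μ : YoungDiagram) (i : ℕ) : ℕ := μ.rowLen i - (i + 1)

/-- The Frobenius coordinate `μ'ᵢ - i`, with the same conventions. -/
def frobQ (μ : YoungDiagram) (i : ℕ) : ℕ := μ.colLen i - (i + 1)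

/-- `c_{pp'} = (-1)^{p-p'} e_{p-p'}(1/2, 3/2, …, (2p-1)/2)` for `p' ≤ p`, and `0` for `p' > p`. -/
noncomputable def c (p p' : ℕ) : ℂ :=
  if p' ≤ p then
    (-1) ^ (p - p') *
      ((Multiset.range p).map fun i => (2 * (i : ℂ) + 1) / 2).esymm (p - p')
  else 0

/-- `c_{μν} = det [c_{pᵢ,p'ⱼ}] det [c_{qᵢ,q'ⱼ}]`, determinants of order `d = d(μ)`; it is used for
`d(ν) = d(μ)`. -/
noncomputable def cDiag (μ ν : YoungDiagram) : ℂ :=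
  Matrix.det (Matrix.of fun i j : Fin (depth μ) => c (frobP μ i) (frobP ν j)) *
    Matrix.det (Matrix.of fun i j : Fin (depth μ) => c (frobQ μ i) (frobQ ν j))

theorem finite_subdiagrams (μ : YoungDiagram) :
    {ν : YoungDiagram | ν ≤ μ ∧ depth ν = depth μ}.Finite := by
  refine Set.Finite.of_finite_image (f := YoungDiagram.cells)
    (Set.Finite.subset (μ.cells.powerset.finite_toSet) ?_) ?_
  · rintro _ ⟨ν, hν, rfl⟩
    simpa using hν.1
  · intro a _ b _ hab
    exact YoungDiagram.ext hab

/-- The diagrams contained in `μ` that have the same number of diagonal squares as `μ`. -/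
noncomputable def subdiagrams (μ : YoungDiagram) : Finset YoungDiagram :=
  (finite_subdiagrams μ).toFinset

end FrobeniusSchur

/-! ### The generating series of the complete homogeneous functions -/

namespace FrobeniusSchur

/-! The inverse of `φ` is explicit: `phiInv` sends the power sum of index k to ∑ᵢ ((xᵢ - i + 1/2)ᵏ -
(1/2 - i)ᵏ). In n variables it carries the series H to ∏ (1 - aᵢt)/(1 - zᵢt), with zᵢ = xᵢ - i + 1/2
and aᵢ = 1/2 - i (`map_phiInvFin_hSeries_mul`). It is injective because over ℂ finitely many shifted
power sums can be given arbitrary values, and surjective because a shifted symmetric polynomial of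
degree at most d is a polynomial in the first d of them.

With v = u + 1/2 = 1/t, form the Jacobi–Trudi type determinant whose entry in row m = μᵢ - i and
column j, counted from 0, is the coefficient of 1/v in H(v) (v - 1/2)^{↓m} vʲ; falling powers with m
< 0 are reciprocals of products. Multiplying its image in n variables by the matrix of coefficients
of the products ∏_{l≠k} (1 - z_l t) leaves a single pole in each entry, and the result is the
numerator of s*_μ (`sum_jtEntry_mul_lagrangeCoeff`). Hence `phiInv` maps the determinant to s*_μ.
The one-row case expresses h*_k through the h_b, and re-expanding 1/(u + 1/2)ᵇ in inverse falling
powers yields φ(H*(u)) = H(u + 1/2). This condition recovers all φ-images of `phiInv h_k`, so it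
also forces uniqueness, and Fs_μ is the determinant.

Replacing (v - 1/2)^{↓m} by vᵐ gives the ordinary Schur function. For either family, eliminating the
unitriangular rows of negative index turns the determinant into a minor of a hook matrix, with rows
pᵢ and columns qⱼ; this is Giambelli's formula (`jtDet_eq_det_hookMatrix`). Passing from vᵐ to
falling powers multiplies the nonnegative rows by the matrix C = (c_{pp'}). Because reciprocal
falling powers mirror the ordinary ones, it multiplies the inverse of the negative rows by Cᵀ, up to
signs built into the hook matrix. So the two hook matrices are related by K ↦ C K Cᵀ
(`hookMatrix_fallingSeries`). Two applications of Cauchy–Binet give the expansion, and triangularity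
of C confines it to the subdiagrams of the same depth. -/

open PowerSeries in
/-- A power series `Y` solving `Y' = Y q` is determined by `q` and its constant coefficient. -/
theorem eq_of_derivative_eq_mul {A : Type*} [CommRing A] [IsAddTorsionFree A]
    {Y Z q : PowerSeries A}
    (hY : derivative A Y = Y * q) (hZ : derivative A Z = Z * q)
    (h0 : constantCoeff Y = constantCoeff Z) : Y = Z := by
  have key : ∀ n, ∀ m ≤ n, coeff m Y = coeff m Z := by
    intro n
    induction n with
    | zero =>
      intro m hm
      obtain rfl : m = 0 := by omega
      simpa using h0
    | succ n ih =>
      intro m hm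
      rcases Nat.lt_or_ge m (n + 1) with h | h
      · exact ih m (by omega)
      · obtain rfl : m = n + 1 := by omega
        have h1 := congrArg (coeff n) hY
        have h2 := congrArg (coeff n) hZ
        rw [coeff_derivative, coeff_mul] at h1 h2
        have h3 : ∑ p ∈ Finset.HasAntidiagonal.antidiagonal n, coeff p.1 Y * coeff p.2 q =
            ∑ p ∈ Finset.HasAntidiagonal.antidiagonal n, coeff p.1 Z * coeff p.2 q :=
          Finset.sum_congr rfl fun p hp => by
            rw [ih p.1 (by have := Finset.HasAntidiagonal.mem_antidiagonal.1 hp; omega)]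
        rw [h3, ← h2] at h1
        have h4 : (n + 1) • coeff (n + 1) Y = (n + 1) • coeff (n + 1) Z := by
          simpa [nsmul_eq_mul, mul_comm] using h1
        exact (nsmul_right_inj (Nat.succ_ne_zero n)).1 h4
  ext n
  exact key n n le_rfl

/-- The series `∑_{k ≥ 0} p_{k+1} tᵏ`. -/
noncomputable def psumGen : PowerSeries Lam := PowerSeries.mk fun k => MvPolynomial.X k.succPNat

theorem derivative_powerSumSeries : PowerSeries.derivative Lam powerSumSeries = psumGen := by
  ext1 n
  rw [PowerSeries.coeff_derivative, psumGen, powerSumSeries, PowerSeries.coeff_mk,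
    PowerSeries.coeff_mk, dif_pos n.succ_pos]
  have h : ((n : Lam) + 1) = MvPolynomial.C ((n : ℂ) + 1) := by simp
  change (MvPolynomial.C (1 / ((n + 1 : ℕ) : ℂ)) : Lam) * (MvPolynomial.X n.succPNat : Lam) *
    ((n : Lam) + 1) =
    MvPolynomial.X n.succPNat
  rw [h, mul_right_comm, ← MvPolynomial.C_mul]
  have h2 : (1 / ((n + 1 : ℕ) : ℂ)) * ((n : ℂ) + 1) = 1 := by
    have : (n : ℂ) + 1 ≠ 0 := by exact_mod_cast n.succ_ne_zero
    push_cast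
    field_simp
  rw [h2, MvPolynomial.C_1, one_mul]

theorem constantCoeff_powerSumSeries : PowerSeries.constantCoeff powerSumSeries = 0 := by
  simp [powerSumSeries, ← PowerSeries.coeff_zero_eq_constantCoeff_apply]

theorem hasSubst_powerSumSeries : PowerSeries.HasSubst powerSumSeries :=
  PowerSeries.HasSubst.of_constantCoeff_zero' constantCoeff_powerSumSeries

/-- The coefficients of exp are moved from ℚ to `Lam` so that the chain rule for `derivative Lam`
applies. -/
theorem hSeries_eq_subst : hSeries = (PowerSeries.exp Lam).subst powerSumSeries := by
  ext1 n
  rw [hSeries, PowerSeries.coeff_subst' hasSubst_powerSumSeries,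
    PowerSeries.coeff_subst' hasSubst_powerSumSeries]
  refine finsum_congr fun d => ?_
  rw [PowerSeries.coeff_exp, PowerSeries.coeff_exp, smul_eq_mul, Algebra.smul_def]
  simp

theorem derivative_hSeries : PowerSeries.derivative Lam hSeries = hSeries * psumGen := by
  rw [hSeries_eq_subst, PowerSeries.derivative_subst hasSubst_powerSumSeries,
    PowerSeries.derivative_exp, derivative_powerSumSeries]

theorem constantCoeff_hSeries : PowerSeries.constantCoeff hSeries = 1 := by
  -- The constant term of exp is split off: what remains has none, and substitution preserves that.
  have h1 : (PowerSeries.exp Lam).subst powerSumSeries =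
      (PowerSeries.exp Lam - 1).subst powerSumSeries + 1 := by
    have := PowerSeries.subst_add hasSubst_powerSumSeries (PowerSeries.exp Lam - 1) 1
    rw [sub_add_cancel] at this
    rw [this]
    congr 1
    rw [← PowerSeries.coe_substAlgHom hasSubst_powerSumSeries, map_one]
  rw [hSeries_eq_subst, h1, map_add, map_one]
  have h2 := PowerSeries.constantCoeff_subst_eq_zero (a := powerSumSeries)
    constantCoeff_powerSumSeries (PowerSeries.exp Lam - 1) (by simp)
  have h3 : PowerSeries.constantCoeff ((PowerSeries.exp Lam - 1).subst powerSumSeries) = 0 := h2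
  rw [h3, zero_add]

/-- Newton's recursion for the complete homogeneous functions. -/
theorem newton_hSeries (n : ℕ) : PowerSeries.coeff (n + 1) hSeries * ((n : Lam) + 1) =
    ∑ p ∈ Finset.HasAntidiagonal.antidiagonal n, PowerSeries.coeff p.1 hSeries *
      MvPolynomial.X p.2.succPNat := by
  have := congrArg (PowerSeries.coeff n) derivative_hSeries
  rw [PowerSeries.coeff_derivative, PowerSeries.coeff_mul] at this
  simpa [psumGen] using this

/-! ### The shifted power sums -/

/-- The shifts `1/2 - i`, `i ≥ 1`, counted from `i = 0`. -/
noncomputable def shiftConst (i : ℕ) : ℂ := -((i : ℂ) + 1 / 2)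

/-- The variables `zᵢ = xᵢ - i + 1/2`. -/
noncomputable def shiftVar {n : ℕ} (i : Fin n) : MvPolynomial (Fin n) ℂ :=
  MvPolynomial.X i + MvPolynomial.C (shiftConst i)

/-- The shifted power sum `∑ᵢ ((xᵢ - i + 1/2)ᵏ - (1/2 - i)ᵏ)` in `n` variables. -/
noncomputable def shiftedPsumFin (k n : ℕ) : MvPolynomial (Fin n) ℂ :=
  ∑ i : Fin n, (shiftVar i ^ k - MvPolynomial.C (shiftConst i ^ k))

theorem shiftedPsumFin_mem (k n : ℕ) : shiftedPsumFin k n ∈ shiftedSymmetric n := by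
  refine ⟨∑ i : Fin n, ((MvPolynomial.X i + MvPolynomial.C (1 / 2 : ℂ)) ^ k -
    MvPolynomial.C (shiftConst i ^ k)), ?_, ?_⟩
  · intro e
    simp only [map_sum, map_sub, map_pow, map_add, MvPolynomial.rename_X, MvPolynomial.rename_C,
      Finset.sum_sub_distrib]
    rw [Equiv.sum_comp e fun i => (MvPolynomial.X i + MvPolynomial.C (1 / 2 : ℂ)) ^ k]
  · simp only [shiftedPsumFin, shiftVar, RingHom.coe_coe, map_sum, map_sub,
      map_pow, map_add, MvPolynomial.aeval_X, MvPolynomial.aeval_C, MvPolynomial.algebraMap_eq]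
    refine Finset.sum_congr rfl fun i _ => ?_
    congr 2
    rw [shiftConst, sub_add, sub_eq_add_neg, ← MvPolynomial.C_add, ← MvPolynomial.C_sub,
      ← MvPolynomial.C_neg]
    congr 2
    ring

/-- At zero the last shifted variable equals its own constant, so the last summand cancels. This is
why the constants are subtracted. -/
theorem specializeLast_shiftedPsumFin (k n : ℕ) :
    specializeLast n (shiftedPsumFin k (n + 1)) = shiftedPsumFin k n := by
  simp only [shiftedPsumFin, specializeLast, shiftVar, map_sum, map_sub, map_pow, map_add,
    MvPolynomial.aeval_X, MvPolynomial.aeval_C, MvPolynomial.algebraMap_eq, Fin.sum_univ_castSucc,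
    Fin.snoc_castSucc, Fin.snoc_last, Fin.val_castSucc, zero_add, sub_self, add_zero]

theorem totalDegree_shiftedPsumFin_le (k n : ℕ) : (shiftedPsumFin k n).totalDegree ≤ k := by
  refine MvPolynomial.totalDegree_finsetSum_le fun i _ => ?_
  refine (MvPolynomial.totalDegree_sub _ _).trans (max_le ?_ (by
    rw [MvPolynomial.totalDegree_C]; exact k.zero_le))
  refine (MvPolynomial.totalDegree_pow _ _).trans ?_
  have : (shiftVar i).totalDegree ≤ 1 :=
    (MvPolynomial.totalDegree_add _ _).trans
      (max_le (MvPolynomial.totalDegree_X _).le (by simp))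
  exact (Nat.mul_le_mul_left k this).trans (by omega)

/-- The shifted power sum `∑ᵢ ((xᵢ - i + 1/2)ᵏ - (1/2 - i)ᵏ)`. -/
noncomputable def shiftedPsum (k : ℕ) : LamStar :=
  ⟨fun n => shiftedPsumFin k n, fun n => shiftedPsumFin_mem k n,
    fun n => specializeLast_shiftedPsumFin k n, k, fun n => totalDegree_shiftedPsumFin_le k n⟩

/-- The homomorphism `Λ → Λ*` sending the power sums to the shifted power sums; it will turn out
to be the inverse of `φ`. -/
noncomputable def phiInv : Lam →ₐ[ℂ] LamStar :=
  MvPolynomial.aeval fun k : ℕ+ => shiftedPsum k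

/-- The restriction of an element of `Λ*` to `n` variables. -/
noncomputable def restr (n : ℕ) : LamStar →ₐ[ℂ] MvPolynomial (Fin n) ℂ :=
  (Pi.evalAlgHom ℂ (fun n : ℕ => MvPolynomial (Fin n) ℂ) n).comp LamStar.val

theorem restr_apply (n : ℕ) (f : LamStar) :
    restr n f = (f : (n : ℕ) → MvPolynomial (Fin n) ℂ) n := rfl

/-- The composition of `phiInv` with the restriction to `n` variables. -/
noncomputable def phiInvFin (n : ℕ) : Lam →ₐ[ℂ] MvPolynomial (Fin n) ℂ := (restr n).comp phiInv

theorem phiInvFin_X (n : ℕ) (k : ℕ+) : phiInvFin n (MvPolynomial.X k) = shiftedPsumFin k n := by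
  simp [phiInvFin, phiInv, restr, shiftedPsum]

theorem specializeLast_phiInvFin (n : ℕ) (f : Lam) :
    specializeLast n (phiInvFin (n + 1) f) = phiInvFin n f :=
  (phiInv f).2.2.1 n

-- The logarithmic derivative of a product of linear factors is minus the generating series of power
-- sums, written without division.
open PowerSeries in
theorem derivative_prod_one_sub {A ι : Type*} [CommRing A] (s : Finset ι) (z : ι → A) :
    derivative A (∏ i ∈ s, (1 - C (z i) * X)) =
      (∏ i ∈ s, (1 - C (z i) * X)) * (-∑ i ∈ s, mk fun k => z i ^ (k + 1)) := by
  classical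
  induction s using Finset.induction_on with
  | empty => simp
  | insert a s ha ih =>
    have h1 : (1 - C (z a) * X) * (mk fun k => z a ^ (k + 1)) = C (z a) := by
      ext n
      rw [sub_mul, one_mul, mul_assoc, map_sub, coeff_C_mul, mul_comm X]
      cases n with
      | zero => simp
      | succ n => simp [pow_succ, mul_comm]
    have h2 : derivative A (1 - C (z a) * X) = -C (z a) := by simp
    rw [Finset.prod_insert ha, Derivation.leibniz, ih, h2, Finset.sum_insert ha, smul_eq_mul,
      smul_eq_mul]
    linear_combination (∏ i ∈ s, (1 - C (z i) * X)) * h1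

open PowerSeries in
theorem constantCoeff_prod_one_sub {A ι : Type*} [CommRing A] (s : Finset ι) (z : ι → A) :
    constantCoeff (∏ i ∈ s, (1 - C (z i) * X)) = 1 := by
  simp [map_prod]

open PowerSeries in
theorem map_psumGen {A : Type*} [CommRing A] (f : Lam →+* A) :
    map f psumGen = mk fun k => f (MvPolynomial.X k.succPNat) := by
  ext n; simp [psumGen]

open PowerSeries in
theorem derivative_map_hSeries {A : Type*} [CommRing A] (f : Lam →+* A) :
    derivative A (map f hSeries) = map f hSeries * map f psumGen := by
  rw [← map_mul, ← derivative_hSeries]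
  ext n
  simp [coeff_derivative]

-- Both sides have constant term 1 and the same logarithmic derivative: on the left, the power sums
-- of the zᵢ coming from H cancel those of the product, leaving only the constants.
open PowerSeries in
theorem map_phiInvFin_hSeries_mul (n : ℕ) :
    map (phiInvFin n : Lam →+* MvPolynomial (Fin n) ℂ) hSeries *
        ∏ i : Fin n, (1 - C (shiftVar i) * X) =
      ∏ i : Fin n, (1 - C (MvPolynomial.C (shiftConst i)) * X) := by
  refine eq_of_derivative_eq_mul (q := -∑ i : Fin n, mk fun k =>
    (MvPolynomial.C (shiftConst i) : MvPolynomial (Fin n) ℂ) ^ (k + 1)) ?_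
    (derivative_prod_one_sub _ _) ?_
  · rw [Derivation.leibniz, derivative_prod_one_sub, derivative_map_hSeries, smul_eq_mul,
      smul_eq_mul]
    have h1 : map (phiInvFin n : Lam →+* MvPolynomial (Fin n) ℂ) psumGen =
        (∑ i : Fin n, mk fun k => shiftVar i ^ (k + 1)) - ∑ i : Fin n, mk fun k =>
          (MvPolynomial.C (shiftConst i) : MvPolynomial (Fin n) ℂ) ^ (k + 1) := by
      rw [map_psumGen]
      ext1 k
      simp only [coeff_mk, RingHom.coe_coe, phiInvFin_X, map_sub, map_sum, shiftedPsumFin,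
        Finset.sum_sub_distrib, MvPolynomial.C_pow, Nat.succPNat_coe, Nat.succ_eq_add_one]
    rw [h1]
    ring
  · rw [map_mul, constantCoeff_prod_one_sub, constantCoeff_prod_one_sub, mul_one,
      ← coeff_zero_eq_constantCoeff_apply, coeff_map, coeff_zero_eq_constantCoeff_apply,
      constantCoeff_hSeries, map_one]

/-! ### Injectivity of `phiInv` -/

open Polynomial in
theorem exists_eq_prod_one_sub (n : ℕ) (T : ℂ[X]) (h0 : T.coeff 0 = 1) (hT : T.natDegree ≤ n) :
    ∃ z : Fin n → ℂ, T = ∏ i, (1 - C (z i) * X) := by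
  induction n generalizing T with
  | zero =>
    refine ⟨Fin.elim0, ?_⟩
    rw [Polynomial.eq_C_of_natDegree_le_zero hT, h0]
    simp
  | succ n ih =>
    rcases Nat.eq_zero_or_pos T.natDegree with h | h
    -- Zero parameters give factors 1 and pad the product when the degree is below the number of
    -- factors.
    · refine ⟨fun _ => 0, ?_⟩
      rw [Polynomial.eq_C_of_natDegree_eq_zero h, h0]
      simp
    · obtain ⟨ρ, hρ⟩ := IsAlgClosed.exists_root T
        (Polynomial.natDegree_pos_iff_degree_pos.1 h).ne'
      obtain ⟨S, hS⟩ := Polynomial.dvd_iff_isRoot.2 hρ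
      have h1 : -ρ * S.coeff 0 = 1 := by
        rw [← h0, hS, Polynomial.mul_coeff_zero]
        simp
      have hρ0 : ρ ≠ 0 := by
        rintro rfl
        simp at h1
      have hS0 : S ≠ 0 := by
        rintro rfl
        simp at h1
      have hd : T.natDegree = 1 + S.natDegree := by
        rw [hS, Polynomial.natDegree_mul (Polynomial.X_sub_C_ne_zero ρ) hS0,
          Polynomial.natDegree_X_sub_C]
      obtain ⟨z, hz⟩ := ih (C (-ρ) * S) (by rw [Polynomial.coeff_C_mul]; exact h1) (by
        rw [Polynomial.natDegree_C_mul (neg_ne_zero.2 hρ0)]; omega)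
      refine ⟨Fin.cons ρ⁻¹ z, ?_⟩
      rw [Fin.prod_univ_succ]
      simp only [Fin.cons_zero, Fin.cons_succ]
      rw [← hz, hS, ← mul_assoc]
      congr 1
      have h2 : C ρ⁻¹ * C ρ = (1 : ℂ[X]) := by rw [← C_mul, inv_mul_cancel₀ hρ0, C_1]
      rw [C_neg]
      linear_combination -X * h2

/-- Homomorphisms agreeing on `h₁, …, hₙ` agree on the power sums `p₁, …, pₙ`. -/
theorem map_X_eq_of_map_hSeries_eq {A : Type*} [CommRing A] (f g : Lam →+* A) (n : ℕ)
    (hfg : ∀ i ≤ n, f (PowerSeries.coeff i hSeries) = g (PowerSeries.coeff i hSeries)) (k : ℕ+)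
    (hk : (k : ℕ) ≤ n) : f (MvPolynomial.X k) = g (MvPolynomial.X k) := by
  have key : ∀ m : ℕ, m + 1 ≤ n →
      f (MvPolynomial.X m.succPNat) = g (MvPolynomial.X m.succPNat) := by
    intro m
    induction m using Nat.strong_induction_on with
    | _ m ih =>
      intro hm
      have hf := congrArg f (newton_hSeries m)
      have hg := congrArg g (newton_hSeries m)
      have h0 : PowerSeries.coeff 0 hSeries = 1 := by
        rw [PowerSeries.coeff_zero_eq_constantCoeff_apply, constantCoeff_hSeries]
      rw [Finset.Nat.sum_antidiagonal_eq_sum_range_succ_mk, Finset.sum_range_succ', h0, one_mul,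
        map_mul, map_add, map_add, map_sum] at hf hg
      rw [hfg (m + 1) hm, map_natCast, map_one] at hf
      rw [map_natCast, map_one] at hg
      have h1 := hf.symm.trans hg
      have h2 : ∀ i ∈ Finset.range m,
          f (PowerSeries.coeff (i + 1) hSeries * MvPolynomial.X (m - (i + 1)).succPNat) =
            g (PowerSeries.coeff (i + 1) hSeries * MvPolynomial.X (m - (i + 1)).succPNat) := by
        intro i hi
        have := Finset.mem_range.1 hi
        rw [map_mul, map_mul, hfg _ (by omega), ih (m - (i + 1)) (by omega) (by omega)]
      rw [Finset.sum_congr rfl h2] at h1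
      exact add_left_cancel h1
  obtain ⟨m, rfl⟩ : ∃ m : ℕ, k = m.succPNat := ⟨k.natPred, by simp⟩
  exact key m hk

-- The values a prescribe H modulo t^(n+1). Matching them requires ∏ (1 - zᵢt) ≡ D/H modulo t^(n+1),
-- so the truncation of D/H is factored over ℂ; Newton's recursion then passes from the h's back to
-- the power sums.
open PowerSeries in
theorem exists_eval_shiftedPsumFin_eq (n : ℕ) (a : ℕ+ → ℂ) :
    ∃ x : Fin n → ℂ, ∀ k : ℕ+, (k : ℕ) ≤ n → MvPolynomial.eval x (shiftedPsumFin k n) = a k := by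
  set Ha : PowerSeries ℂ := map (MvPolynomial.eval a) hSeries with hHa
  set D : PowerSeries ℂ := ∏ i : Fin n, (1 - C (shiftConst i) * X) with hD
  have hHa0 : constantCoeff Ha = 1 := by
    rw [hHa, ← coeff_zero_eq_constantCoeff_apply, coeff_map, coeff_zero_eq_constantCoeff_apply,
      constantCoeff_hSeries, map_one]
  have hD0 : constantCoeff D = 1 := constantCoeff_prod_one_sub _ _
  set S := D * Ha⁻¹ with hS
  have hHS : Ha * S = D := by
    rw [hS, mul_left_comm, PowerSeries.mul_inv_cancel _ (by rw [hHa0]; exact one_ne_zero), mul_one]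
  have hS0 : coeff 0 S = 1 := by
    have := congrArg constantCoeff hHS
    rw [map_mul, hHa0, hD0, one_mul] at this
    rw [coeff_zero_eq_constantCoeff_apply, this]
  obtain ⟨z, hz⟩ := exists_eq_prod_one_sub n (trunc (n + 1) S)
    (by rw [coeff_trunc, if_pos n.succ_pos, hS0]) (Nat.lt_succ_iff.1 (natDegree_trunc_lt S n))
  set T : PowerSeries ℂ := ∏ i, (1 - C (z i) * X) with hT
  have hzT : ((trunc (n + 1) S : Polynomial ℂ) : PowerSeries ℂ) = T := by
    rw [hz, ← Polynomial.coeToPowerSeries.ringHom_apply, map_prod, hT]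
    simp
  have hT0 : constantCoeff T = 1 := constantCoeff_prod_one_sub _ _
  let x : Fin n → ℂ := fun i => z i - shiftConst i
  refine ⟨x, ?_⟩
  have hxz : ∀ i : Fin n, MvPolynomial.eval x (shiftVar i) = z i := by
    intro i
    simp [shiftVar, x]
  let f : Lam →+* ℂ := (MvPolynomial.eval x).comp (phiInvFin n : Lam →+* MvPolynomial (Fin n) ℂ)
  have hf : map f hSeries * T = D := by
    have := congrArg (map (MvPolynomial.eval x)) (map_phiInvFin_hSeries_mul n)
    rw [map_mul, map_prod, map_prod, ← RingHom.comp_apply, ← PowerSeries.map_comp] at this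
    simpa [hxz, hT, hD, f] using this
  have hdvd : X ^ (n + 1) ∣ Ha - map f hSeries := by
    have h1 : X ^ (n + 1) ∣ T - S := by
      rw [X_pow_dvd_iff]
      intro m hm
      rw [map_sub, ← hzT, Polynomial.coeff_coe, coeff_trunc, if_pos hm, sub_self]
    have h2 : Ha - map f hSeries = Ha * (T - S) * T⁻¹ := by
      rw [mul_sub, hHS, ← hf, ← sub_mul, mul_assoc, PowerSeries.mul_inv_cancel, mul_one]
      rw [hT0]; exact one_ne_zero
    rw [h2]
    exact (h1.mul_left _).mul_right _
  rw [X_pow_dvd_iff] at hdvd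
  intro k hk
  have := map_X_eq_of_map_hSeries_eq (MvPolynomial.eval a) f n (fun i hi => by
    have := hdvd i (by omega)
    rw [map_sub, sub_eq_zero, hHa, coeff_map, coeff_map] at this
    exact this) k hk
  rw [MvPolynomial.eval_X] at this
  rw [this, ← phiInvFin_X]
  rfl

/-- Every point of the first n coordinates is realised by shifted power sums in n variables, so Q
vanishes as a function. -/
theorem eq_zero_of_phiInvFin_eq_zero {n : ℕ} {Q : Lam}
    (hQ : Q ∈ MvPolynomial.supported ℂ {k : ℕ+ | (k : ℕ) ≤ n}) (h : phiInvFin n Q = 0) : Q = 0 := by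
  refine MvPolynomial.funext fun a => ?_
  obtain ⟨x, hx⟩ := exists_eval_shiftedPsumFin_eq n a
  have h1 : MvPolynomial.supported ℂ {k : ℕ+ | (k : ℕ) ≤ n} ≤
      AlgHom.equalizer ((MvPolynomial.aeval x).comp (phiInvFin n)) (MvPolynomial.aeval a) := by
    refine AlgHom.adjoin_le_equalizer _ _ ?_
    rintro _ ⟨k, hk, rfl⟩
    have := hx k hk
    simpa [phiInvFin_X, MvPolynomial.aeval_eq_eval] using this
  have h2 := h1 hQ
  rw [AlgHom.mem_equalizer, AlgHom.comp_apply, h, map_zero] at h2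
  rw [map_zero, ← MvPolynomial.coe_aeval_eq_eval, RingHom.coe_coe, ← h2]

theorem phiInv_injective : Function.Injective phiInv := by
  rw [injective_iff_map_eq_zero]
  intro Q hQ
  refine eq_zero_of_phiInvFin_eq_zero (n := Q.vars.sup fun k : ℕ+ => (k : ℕ)) ?_ ?_
  · rw [MvPolynomial.mem_supported]
    intro k hk
    exact Finset.le_sup (f := fun k : ℕ+ => (k : ℕ)) hk
  · rw [phiInvFin, AlgHom.comp_apply, hQ, map_zero]

/-! ### Surjectivity of `phiInv` -/

theorem totalDegree_aeval_le_of_forall_le_one {σ τ : Type*} (g : σ → MvPolynomial τ ℂ)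
    (hg : ∀ i, (g i).totalDegree ≤ 1) (p : MvPolynomial σ ℂ) :
    (MvPolynomial.aeval g p).totalDegree ≤ p.totalDegree := by
  rw [MvPolynomial.aeval_def, MvPolynomial.eval₂_eq]
  refine MvPolynomial.totalDegree_finsetSum_le fun m hm => ?_
  refine (MvPolynomial.totalDegree_mul _ _).trans ?_
  rw [MvPolynomial.algebraMap_eq, MvPolynomial.totalDegree_C, zero_add]
  refine (MvPolynomial.totalDegree_finsetProd _ _).trans ?_
  refine le_trans ?_ (MvPolynomial.le_totalDegree hm)
  refine Finset.sum_le_sum fun i _ => (MvPolynomial.totalDegree_pow _ _).trans ?_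
  exact (Nat.mul_le_mul_left _ (hg i)).trans (mul_one _).le

theorem isHomogeneous_psum (n k : ℕ) : (MvPolynomial.psum (Fin n) ℂ k).IsHomogeneous k :=
  MvPolynomial.IsHomogeneous.sum _ _ _ fun i _ => MvPolynomial.isHomogeneous_X_pow i k

/-- Newton's identities, where division by k is allowed in characteristic zero. -/
theorem esymm_mem_adjoin_psum (n k : ℕ) : MvPolynomial.esymm (Fin n) ℂ k ∈
    Algebra.adjoin ℂ (Set.range fun k : ℕ+ => MvPolynomial.psum (Fin n) ℂ k) := by
  induction k using Nat.strong_induction_on with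
  | _ k ih =>
    rcases Nat.eq_zero_or_pos k with rfl | hk
    · rw [MvPolynomial.esymm_zero]
      exact one_mem _
    · have h := MvPolynomial.mul_esymm_eq_sum (Fin n) ℂ k
      have h1 : MvPolynomial.esymm (Fin n) ℂ k =
          (1 / (k : ℂ)) • ((k : MvPolynomial (Fin n) ℂ) * MvPolynomial.esymm (Fin n) ℂ k) := by
        have hk0 : (k : ℂ) ≠ 0 := by exact_mod_cast hk.ne'
        rw [← nsmul_eq_mul, ← Nat.cast_smul_eq_nsmul ℂ, smul_smul, one_div, inv_mul_cancel₀ hk0,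
          one_smul]
      rw [h1, h]
      refine Subalgebra.smul_mem _ (mul_mem (pow_mem (neg_mem (one_mem _)) _)
        (sum_mem fun a ha => mul_mem (mul_mem (pow_mem (neg_mem (one_mem _)) _) ?_) ?_)) _
      · exact ih _ (Finset.mem_filter.1 ha).2
      · have h2 := Finset.mem_filter.1 ha
        have h3 := Finset.HasAntidiagonal.mem_antidiagonal.1 h2.1
        exact Algebra.subset_adjoin ⟨⟨a.2, by omega⟩, rfl⟩

theorem symmetric_mem_adjoin_psum {n : ℕ} {g : MvPolynomial (Fin n) ℂ} (hg : g.IsSymmetric) :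
    g ∈ Algebra.adjoin ℂ (Set.range fun k : ℕ+ => MvPolynomial.psum (Fin n) ℂ k) := by
  obtain ⟨q, hq⟩ := MvPolynomial.esymmAlgHom_fin_surjective ℂ (le_refl n) ⟨g, hg⟩
  have h1 := congrArg Subtype.val hq
  rw [MvPolynomial.esymmAlgHom_apply] at h1
  change _ = g at h1
  rw [← h1]
  have h2 : MvPolynomial.aeval (fun i : Fin n => MvPolynomial.esymm (Fin n) ℂ (i + 1)) q ∈
      Algebra.adjoin ℂ (Set.range fun i : Fin n => MvPolynomial.esymm (Fin n) ℂ (i + 1)) := by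
    rw [Algebra.adjoin_range_eq_range_aeval]
    exact ⟨q, rfl⟩
  refine Algebra.adjoin_le ?_ h2
  rintro _ ⟨i, rfl⟩
  exact esymm_mem_adjoin_psum n _

/-- A symmetric polynomial of degree at most `d` is a polynomial in the power sums of index at
most `d`. -/
theorem symmetric_mem_adjoin_psum_of_totalDegree_le {n d : ℕ} {g : MvPolynomial (Fin n) ℂ}
    (hg : g.IsSymmetric) (hd : g.totalDegree ≤ d) :
    g ∈ Algebra.adjoin ℂ ((fun k : ℕ+ => MvPolynomial.psum (Fin n) ℂ k) ''
      {k : ℕ+ | (k : ℕ) ≤ d}) := by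
  have h1 := symmetric_mem_adjoin_psum hg
  rw [Algebra.adjoin_range_eq_range_aeval] at h1
  obtain ⟨Q, hQ⟩ := h1
  -- The degree of `Q` is not controlled. In a component of degree i ≤ d, however, only monomials of
  -- weight i in the power sums survive, and these involve indices at most i.
  rw [← MvPolynomial.sum_homogeneousComponent g]
  refine sum_mem fun i hi => ?_
  have hi' : i ≤ d := by have := Finset.mem_range.1 hi; omega
  change MvPolynomial.aeval _ Q = g at hQ
  rw [← hQ, MvPolynomial.aeval_def, MvPolynomial.eval₂_eq, map_sum]
  refine sum_mem fun m _ => ?_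
  rw [MvPolynomial.algebraMap_eq, MvPolynomial.homogeneousComponent_C_mul]
  refine mul_mem (Subalgebra.algebraMap_mem _ _) ?_
  have h2 : (∏ k ∈ m.support, MvPolynomial.psum (Fin n) ℂ (k : ℕ) ^ m k).IsHomogeneous
      (∑ k ∈ m.support, (k : ℕ) * m k) :=
    MvPolynomial.IsHomogeneous.prod _ _ _ fun k _ => (isHomogeneous_psum n k).pow _
  rw [MvPolynomial.homogeneousComponent_of_mem h2]
  split_ifs with h
  · refine prod_mem fun k hk => pow_mem
      (Algebra.subset_adjoin (Set.mem_image_of_mem _ ?_)) _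
    have h3 := Finset.single_le_sum (f := fun k : ℕ+ => (k : ℕ) * m k)
      (fun _ _ => Nat.zero_le _) hk
    have h4 : 0 < m k := Nat.pos_of_ne_zero (Finsupp.mem_support_iff.1 hk)
    have h5 : (k : ℕ) * 1 ≤ (k : ℕ) * m k := Nat.mul_le_mul_left _ h4
    change (k : ℕ) ≤ d
    omega
  · exact zero_mem _

theorem sum_shiftVar_pow_mem (n d l : ℕ) (hl : l ≤ d) :
    ∑ i : Fin n, shiftVar i ^ l ∈
      Algebra.adjoin ℂ ((fun k : ℕ+ => shiftedPsumFin k n) '' {k : ℕ+ | (k : ℕ) ≤ d}) := by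
  have h1 : ∑ i : Fin n, shiftVar i ^ l =
      shiftedPsumFin l n + ∑ i : Fin n, MvPolynomial.C (shiftConst i ^ l) := by
    rw [shiftedPsumFin, Finset.sum_sub_distrib, sub_add_cancel]
  rw [h1]
  refine add_mem ?_ (sum_mem fun i _ => Subalgebra.algebraMap_mem _ _)
  rcases Nat.eq_zero_or_pos l with rfl | h
  · have : shiftedPsumFin 0 n = 0 := by simp [shiftedPsumFin]
    rw [this]
    exact zero_mem _
  · exact Algebra.subset_adjoin ⟨⟨l, h⟩, hl, rfl⟩

/-- The translation undoing the shift does not raise the degree, so the symmetric case applies with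
the same d. Translated power sums are then expanded by the binomial theorem around the half-integer
shift. -/
theorem shiftedSymmetric_mem_adjoin {n d : ℕ} {f : MvPolynomial (Fin n) ℂ}
    (hf : f ∈ shiftedSymmetric n) (hd : f.totalDegree ≤ d) :
    f ∈ Algebra.adjoin ℂ ((fun k : ℕ+ => shiftedPsumFin k n) '' {k : ℕ+ | (k : ℕ) ≤ d}) := by
  obtain ⟨g, hg, hgf⟩ := hf
  set τ : MvPolynomial (Fin n) ℂ →ₐ[ℂ] MvPolynomial (Fin n) ℂ :=
    MvPolynomial.aeval fun j : Fin n =>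
      (MvPolynomial.X j - MvPolynomial.C (((j : ℕ) : ℂ) + 1) : MvPolynomial (Fin n) ℂ) with hτ
  change τ g = f at hgf
  let τ' : MvPolynomial (Fin n) ℂ →ₐ[ℂ] MvPolynomial (Fin n) ℂ :=
    MvPolynomial.aeval fun j : Fin n =>
      (MvPolynomial.X j + MvPolynomial.C (((j : ℕ) : ℂ) + 1) : MvPolynomial (Fin n) ℂ)
  have h1 : τ' f = g := by
    have : τ'.comp τ = AlgHom.id ℂ _ := by
      ext j
      simp [τ, τ']
    rw [← hgf, ← AlgHom.comp_apply, this, AlgHom.id_apply]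
  have h2 : g.totalDegree ≤ d := by
    rw [← h1]
    refine (totalDegree_aeval_le_of_forall_le_one _ (fun j => ?_) f).trans hd
    exact (MvPolynomial.totalDegree_add _ _).trans
      (max_le (MvPolynomial.totalDegree_X _).le
        (by rw [MvPolynomial.totalDegree_C]; exact zero_le_one))
  have h3 := Subalgebra.mem_map.2 ⟨g, symmetric_mem_adjoin_psum_of_totalDegree_le hg h2, hgf⟩
  rw [← Algebra.adjoin_image] at h3
  refine Algebra.adjoin_le ?_ h3
  rintro _ ⟨_, ⟨k, hk, rfl⟩, rfl⟩
  have h4 : τ (MvPolynomial.psum (Fin n) ℂ k) =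
      ∑ l ∈ Finset.range ((k : ℕ) + 1),
        (∑ i : Fin n, shiftVar i ^ l) * MvPolynomial.C ((-(1 / 2)) ^ ((k : ℕ) - l) *
          ((k : ℕ).choose l : ℂ)) := by
    simp only [Finset.sum_mul]
    rw [Finset.sum_comm, MvPolynomial.psum, map_sum]
    refine Finset.sum_congr rfl fun i _ => ?_
    have h5 : τ (MvPolynomial.X i) = shiftVar i + MvPolynomial.C (-(1 / 2)) := by
      rw [hτ, MvPolynomial.aeval_X, shiftVar, sub_eq_add_neg, ← MvPolynomial.C_neg, add_assoc,
        ← MvPolynomial.C_add]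
      congr 2
      rw [shiftConst]
      ring
    rw [map_pow, h5, add_pow]
    refine Finset.sum_congr rfl fun l _ => ?_
    rw [MvPolynomial.C_mul, MvPolynomial.C_pow, map_natCast]
    ring
  rw [SetLike.mem_coe]
  change τ (MvPolynomial.psum (Fin n) ℂ k) ∈ _
  rw [h4]
  refine sum_mem fun l hl => mul_mem (sum_shiftVar_pow_mem n d l ?_) (Subalgebra.algebraMap_mem _ _)
  have := Finset.mem_range.1 hl
  have : (k : ℕ) ≤ d := hk
  omega

theorem LamStar_ext_of_le {f g : LamStar} (N : ℕ) (h : ∀ n, N ≤ n → restr n f = restr n g) :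
    f = g := by
  have key : ∀ j n, N ≤ n + j → restr n f = restr n g := by
    intro j
    induction j with
    | zero => exact fun n hn => h n hn
    | succ j ih =>
      intro n hn
      have h1 := congrArg (specializeLast n) (ih (n + 1) (by omega))
      rwa [restr_apply, restr_apply, f.2.2.1 n, g.2.2.1 n] at h1
  exact Subtype.ext (funext fun n => key N n (by omega))

theorem phiInv_surjective : Function.Surjective phiInv := by
  intro f
  obtain ⟨d, hd⟩ := f.2.2.2
  have h1 : ∀ n, ∃ Q ∈ MvPolynomial.supported ℂ {k : ℕ+ | (k : ℕ) ≤ d},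
      phiInvFin n Q = restr n f := by
    intro n
    have h := shiftedSymmetric_mem_adjoin (f.2.1 n) (hd n)
    have h2 : (fun k : ℕ+ => shiftedPsumFin k n) '' {k : ℕ+ | (k : ℕ) ≤ d} =
        phiInvFin n '' (MvPolynomial.X '' {k : ℕ+ | (k : ℕ) ≤ d}) := by
      rw [← Set.image_comp]
      exact Set.image_congr fun k _ => (phiInvFin_X n k).symm
    rw [h2, Algebra.adjoin_image] at h
    exact h
  choose Q hQ hQf using h1
  -- All the Q n involve only variables of index at most d; `phiInvFin n` is injective on those once
  -- d ≤ n, so compatibility under specialization makes them constant.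
  have h2 : ∀ n, d ≤ n → Q n = Q d := by
    intro n hn
    induction n, hn using Nat.le_induction with
    | base => rfl
    | succ n hn ih =>
      rw [← ih, ← sub_eq_zero]
      refine eq_zero_of_phiInvFin_eq_zero (n := n) ?_ ?_
      · have h3 : Q (n + 1) - Q n ∈ MvPolynomial.supported ℂ {k : ℕ+ | (k : ℕ) ≤ d} :=
          Subalgebra.sub_mem _ (hQ (n + 1)) (hQ n)
        have h4 : {k : ℕ+ | (k : ℕ) ≤ d} ⊆ {k : ℕ+ | (k : ℕ) ≤ n} := fun k hk => le_trans hk hn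
        exact MvPolynomial.supported_mono h4 h3
      · rw [map_sub, hQf n, ← specializeLast_phiInvFin, hQf (n + 1), sub_eq_zero]
        exact f.2.2.1 n
  refine ⟨Q d, LamStar_ext_of_le d fun n hn => ?_⟩
  rw [← hQf n, h2 n hn]
  rfl

/-- The isomorphism `Λ ≃ Λ*` sending the power sums to the shifted power sums. -/
noncomputable def phiInvEquiv : Lam ≃ₐ[ℂ] LamStar :=
  AlgEquiv.ofBijective phiInv ⟨phiInv_injective, phiInv_surjective⟩

/-! ### Jacobi–Trudi determinants -/

/-- The coefficient of `Xᵏ` for an integer `k`, which is `0` for `k < 0`. -/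
noncomputable def icoeff {A : Type*} [CommRing A] (k : ℤ) : PowerSeries A →ₗ[A] A :=
  if 0 ≤ k then PowerSeries.coeff k.toNat else 0

section icoeff

variable {A B : Type*} [CommRing A] [CommRing B]

theorem icoeff_natCast (k : ℕ) (F : PowerSeries A) :
    icoeff (k : ℤ) F = PowerSeries.coeff k F := by
  simp [icoeff]

theorem icoeff_of_neg {k : ℤ} (hk : k < 0) (F : PowerSeries A) : icoeff k F = 0 := by
  simp [icoeff, not_le.2 hk]

theorem map_icoeff (f : A →+* B) (k : ℤ) (F : PowerSeries A) :
    f (icoeff k F) = icoeff k (PowerSeries.map f F) := by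
  unfold icoeff
  split_ifs <;> simp

theorem icoeff_X_pow_mul (k : ℤ) (l : ℕ) (F : PowerSeries A) :
    icoeff k (PowerSeries.X ^ l * F) = icoeff (k - l) F := by
  rcases lt_or_ge k 0 with h | h
  · rw [icoeff_of_neg h, icoeff_of_neg (by omega)]
  · obtain ⟨k, rfl⟩ := Int.eq_ofNat_of_zero_le h
    rw [icoeff_natCast, PowerSeries.coeff_X_pow_mul']
    split_ifs with h1
    · rw [← Nat.cast_sub h1, icoeff_natCast]
    · rw [icoeff_of_neg (by omega)]

theorem icoeff_C_mul (k : ℤ) (a : A) (F : PowerSeries A) :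
    icoeff k (PowerSeries.C a * F) = a * icoeff k F := by
  rw [← PowerSeries.smul_eq_C_mul, map_smul, smul_eq_mul]

end icoeff

/-- The series `(1 - t/2) (1 - 3t/2) ⋯ (1 - (2p-1)t/2)`. -/
noncomputable def numSeries (p : ℕ) : PowerSeries ℂ :=
  ∏ i ∈ Finset.range p, (1 - PowerSeries.C ((i : ℂ) + 1 / 2) * PowerSeries.X)

/-- The series `(1 + t/2) (1 + 3t/2) ⋯ (1 + (2q-1)t/2)`. -/
noncomputable def denSeries (q : ℕ) : PowerSeries ℂ :=
  ∏ i ∈ Finset.range q, (1 + PowerSeries.C ((i : ℂ) + 1 / 2) * PowerSeries.X)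

/-- The generalized falling factorial power `(v - 1/2)^{↓m}`, divided by `vᵐ`, as a series
in `1/v`. -/
noncomputable def fallingSeries : ℤ → PowerSeries ℂ
  | Int.ofNat p => numSeries p
  | Int.negSucc q => (denSeries (q + 1))⁻¹

theorem constantCoeff_denSeries (q : ℕ) : PowerSeries.constantCoeff (denSeries q) = 1 := by
  simp [denSeries, map_prod]

theorem denSeries_mul_inv (q : ℕ) : denSeries q * (denSeries q)⁻¹ = 1 :=
  PowerSeries.mul_inv_cancel _ (by rw [constantCoeff_denSeries]; exact one_ne_zero)

theorem denSeries_succ (q : ℕ) : denSeries (q + 1) =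
    denSeries q * (1 + PowerSeries.C ((q : ℂ) + 1 / 2) * PowerSeries.X) :=
  Finset.prod_range_succ _ _

theorem constantCoeff_fallingSeries_negSucc (q : ℕ) :
    PowerSeries.constantCoeff (fallingSeries (Int.negSucc q)) = 1 := by
  simp [fallingSeries, constantCoeff_denSeries]

theorem fallingSeries_neg (n : ℕ) : fallingSeries (-(n : ℤ)) = (denSeries n)⁻¹ := by
  cases n with
  | zero =>
    change numSeries 0 = _
    simp [numSeries, denSeries]
  | succ n => rfl

theorem fallingSeries_succ (m : ℤ) : fallingSeries (m + 1) =
    fallingSeries m * (1 - PowerSeries.C ((m : ℂ) + 1 / 2) * PowerSeries.X) := by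
  rcases m with p | q
  · change numSeries (p + 1) = numSeries p * _
    rw [numSeries, Finset.prod_range_succ]
    rfl
  · have h1 : Int.negSucc q + 1 = -(q : ℤ) := by rw [Int.negSucc_eq]; ring
    rw [h1, fallingSeries_neg, fallingSeries]
    have h2 : 1 - PowerSeries.C (((Int.negSucc q : ℤ) : ℂ) + 1 / 2) * PowerSeries.X =
        1 + PowerSeries.C ((q : ℂ) + 1 / 2) * PowerSeries.X := by
      have h3 : ((Int.negSucc q : ℤ) : ℂ) + 1 / 2 = -((q : ℂ) + 1 / 2) := by
        rw [Int.cast_negSucc]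
        push_cast
        ring
      rw [h3, map_neg]
      ring
    rw [h2]
    have h4 := denSeries_mul_inv (q + 1)
    rw [denSeries_succ] at h4 ⊢
    have h5 := denSeries_mul_inv q
    set x := 1 + PowerSeries.C ((q : ℂ) + 1 / 2) * PowerSeries.X
    linear_combination (-(denSeries q)⁻¹) * h4 + (denSeries q * x)⁻¹ * x * h5

/-- Clearing the denominator gives one product of r factors, whatever the sign of r - n. -/
theorem fallingSeries_mul_denSeries (r n : ℕ) : fallingSeries ((r : ℤ) - n) * denSeries n =
    ∏ l ∈ Finset.range r,
      (1 + PowerSeries.C ((n : ℂ) - 1 / 2 - l) * PowerSeries.X) := by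
  induction r with
  | zero =>
    rw [Nat.cast_zero, zero_sub, fallingSeries_neg, mul_comm, denSeries_mul_inv]
    simp
  | succ r ih =>
    rw [Finset.prod_range_succ, ← ih]
    have h1 : ((r + 1 : ℕ) : ℤ) - n = ((r : ℤ) - n) + 1 := by push_cast; ring
    rw [h1, fallingSeries_succ]
    have h2 : ((((r : ℤ) - n : ℤ) : ℂ) + 1 / 2) = -((n : ℂ) - 1 / 2 - r) := by push_cast; ring
    rw [h2, map_neg]
    ring

/-- The entry in row `m` and column `j` (counted from `0`) of the Jacobi–Trudi matrix attached to
a family `g` of series: the coefficient of `1/v` in `H(v) vᵐ g_m vʲ`. -/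
noncomputable def jtEntry (g : ℤ → PowerSeries ℂ) (m : ℤ) (j : ℕ) : Lam :=
  icoeff (m + j + 1) (hSeries * PowerSeries.map (algebraMap ℂ Lam) (g m))

/-- The Jacobi–Trudi determinant of order `n` attached to a family `g` of series. -/
noncomputable def jtDet (g : ℤ → PowerSeries ℂ) (n : ℕ) (μ : YoungDiagram) : Lam :=
  Matrix.det (Matrix.of fun i j : Fin n => jtEntry g ((μ.rowLen i : ℤ) - ((i : ℕ) + 1)) j)

theorem jtEntry_negSucc (g : ℤ → PowerSeries ℂ) (a j : ℕ) : jtEntry g (Int.negSucc a) j =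
    icoeff ((j : ℤ) - a) (hSeries * PowerSeries.map (algebraMap ℂ Lam) (g (Int.negSucc a))) := by
  rw [jtEntry]
  congr 1
  rw [Int.negSucc_eq]
  congr 1
  ring

theorem jtEntry_negSucc_of_lt (g : ℤ → PowerSeries ℂ) {a j : ℕ} (h : j < a) :
    jtEntry g (Int.negSucc a) j = 0 := by
  rw [jtEntry_negSucc, icoeff_of_neg (by omega)]

theorem jtEntry_negSucc_self (g : ℤ → PowerSeries ℂ) (a : ℕ)
    (hg : PowerSeries.constantCoeff (g (Int.negSucc a)) = 1) :
    jtEntry g (Int.negSucc a) a = 1 := by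
  rw [jtEntry_negSucc, sub_self, ← Nat.cast_zero, icoeff_natCast,
    PowerSeries.coeff_zero_eq_constantCoeff_apply, map_mul, constantCoeff_hSeries, one_mul,
    ← PowerSeries.coeff_zero_eq_constantCoeff_apply, PowerSeries.coeff_map,
    PowerSeries.coeff_zero_eq_constantCoeff_apply, hg, map_one]

theorem rowLen_eq_zero_of_colLen_le {μ : YoungDiagram} {n : ℕ} (h : μ.colLen 0 ≤ n) :
    μ.rowLen n = 0 := by
  by_contra h0
  have h1 : (n, 0) ∈ μ := YoungDiagram.mem_iff_lt_rowLen.2 (Nat.pos_of_ne_zero h0)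
  have h2 := YoungDiagram.mem_iff_lt_colLen.1 h1
  omega

/-- Below the diagram, the row of index -(n + 1) vanishes before the diagonal and has 1 on it, so
expansion along it removes the last row and column. -/
theorem jtDet_succ (g : ℤ → PowerSeries ℂ)
    (hg : ∀ a, PowerSeries.constantCoeff (g (Int.negSucc a)) = 1) {μ : YoungDiagram} {n : ℕ}
    (h : μ.colLen 0 ≤ n) : jtDet g (n + 1) μ = jtDet g n μ := by
  rw [jtDet, Matrix.det_succ_row _ (Fin.last n), Finset.sum_eq_single (Fin.last n)]
  · have h1 : ((μ.rowLen n : ℤ) - ((n : ℕ) + 1)) = Int.negSucc n := by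
      rw [rowLen_eq_zero_of_colLen_le h, Int.negSucc_eq]
      push_cast
      ring
    rw [Matrix.of_apply, Fin.val_last, h1, jtEntry_negSucc_self g n (hg n), mul_one,
      Even.neg_one_pow ⟨n, rfl⟩, one_mul, jtDet]
    congr 1
    ext i j
    simp
  · intro j _ hj
    have h1 : ((μ.rowLen n : ℤ) - ((n : ℕ) + 1)) = Int.negSucc n := by
      rw [rowLen_eq_zero_of_colLen_le h, Int.negSucc_eq]
      push_cast
      ring
    have h2 : (j : ℕ) < n := by
      have := Fin.val_lt_last hj
      exact this
    rw [Matrix.of_apply, Fin.val_last, h1, jtEntry_negSucc_of_lt g h2, mul_zero, zero_mul]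
  · simp

theorem jtDet_eq_of_le (g : ℤ → PowerSeries ℂ)
    (hg : ∀ a, PowerSeries.constantCoeff (g (Int.negSucc a)) = 1) {μ : YoungDiagram} {n : ℕ}
    (h : μ.colLen 0 ≤ n) : jtDet g n μ = jtDet g (μ.colLen 0) μ := by
  induction n, h using Nat.le_induction with
  | base => rfl
  | succ n hn ih => rw [jtDet_succ g hg hn, ih]

theorem schur_eq_jtDet (μ : YoungDiagram) : schur μ = jtDet (fun _ => 1) (μ.colLen 0) μ := by
  rw [schur, jtDet]
  congr 1
  ext1 i j
  rw [Matrix.of_apply, Matrix.of_apply, jtEntry, map_one, mul_one, h, icoeff]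
  have : (μ.rowLen i : ℤ) - ((i : ℕ) + 1) + (j : ℕ) + 1 =
      (μ.rowLen i : ℤ) - ((i : ℕ) : ℤ) + ((j : ℕ) : ℤ) := by ring
  rw [this]
  split_ifs <;> rfl

/-! ### Shifted Schur functions as Jacobi–Trudi determinants -/

section interpolation

variable {A : Type*} [CommRing A]

open PowerSeries

theorem coeff_prod_one_add_of_lt {ι : Type*} (s : Finset ι) (b : ι → A) {k : ℕ}
    (hk : s.card < k) : coeff k (∏ l ∈ s, (1 + C (b l) * X)) = 0 := by
  classical
  induction s using Finset.induction_on generalizing k with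
  | empty =>
    rw [Finset.prod_empty, coeff_one, if_neg]
    rintro rfl
    simp at hk
  | insert a s ha ih =>
    rw [Finset.card_insert_of_notMem ha] at hk
    obtain ⟨k, rfl⟩ : ∃ j, k = j + 1 := ⟨k - 1, by omega⟩
    rw [Finset.prod_insert ha, add_mul, one_mul, mul_assoc, map_add, coeff_C_mul,
      coeff_succ_X_mul, ih (by omega), ih (by omega), mul_zero, add_zero]

/-- The coefficient of `tʳ` in `∏_{l<r} (1 + b_l t) / (1 - z t)`. -/
theorem coeff_prod_one_add_mul {z : A} {G : PowerSeries A} (hG : (1 - C z * X) * G = 1)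
    (b : ℕ → A) (r : ℕ) : coeff r ((∏ l ∈ Finset.range r, (1 + C (b l) * X)) * G) =
      ∏ l ∈ Finset.range r, (z + b l) := by
  induction r with
  | zero =>
    have := congrArg (coeff 0) hG
    simpa using this
  | succ r ih =>
    set Φ := ∏ l ∈ Finset.range r, (1 + C (b l) * X) with hΦ
    have h1 : Φ * G = Φ + C z * (X * (Φ * G)) := by linear_combination Φ * hG
    -- Φ has degree at most r, so beyond degree r the coefficients of Φ·G form a geometric sequence
    -- of ratio z.
    have h2 : coeff (r + 1) (Φ * G) = z * coeff r (Φ * G) := by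
      conv_lhs => rw [h1]
      rw [map_add, hΦ, coeff_prod_one_add_of_lt _ _ (by simp), zero_add, coeff_C_mul,
        coeff_succ_X_mul]
    have h3 : Φ * (1 + C (b r) * X) * G = Φ * G + C (b r) * (X * (Φ * G)) := by ring
    rw [Finset.prod_range_succ, Finset.prod_range_succ, ← ih, ← hΦ, h3, map_add, h2, coeff_C_mul,
      coeff_succ_X_mul]
    ring

theorem eq_sum_coeff_rev {n : ℕ} {E : PowerSeries A} (hE : ∀ k, n ≤ k → coeff k E = 0) :
    E = ∑ j : Fin n, C (coeff (n - 1 - (j : ℕ)) E) * X ^ (n - 1 - (j : ℕ)) := by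
  ext k
  rw [map_sum]
  simp only [coeff_C_mul, coeff_X_pow, mul_ite, mul_one, mul_zero]
  rcases Nat.lt_or_ge k n with h | h
  · rw [Finset.sum_eq_single (⟨n - 1 - k, by omega⟩ : Fin n)]
    · have : n - 1 - (n - 1 - k) = k := by omega
      simp only [this, if_true]
    · intro j _ hj
      rw [if_neg]
      intro hk
      exact hj (Fin.ext (by have := j.2; simp only; omega))
    · simp
  · rw [hE k h, Finset.sum_eq_zero]
    intro j _
    rw [if_neg]
    have := j.2
    omega

end interpolation

/-- The coefficients of `∏_{l ≠ k} (1 - z_l t)`, in reverse order. -/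
noncomputable def lagrangeCoeff (n : ℕ) (k j : Fin n) : MvPolynomial (Fin n) ℂ :=
  PowerSeries.coeff (n - 1 - (j : ℕ))
    (∏ l ∈ Finset.univ.erase k, (1 - PowerSeries.C (shiftVar l) * PowerSeries.X))

-- The sum over j is a convolution, namely the coefficient of tʳ in E·H·(falling series). Here E·H
-- is `denSeries n` divided by 1 - z_k t, because every other pole is cancelled by E. Clearing
-- denominators leaves r linear factors over 1 - z_k t, and extracting the coefficient evaluates
-- them at z_k.
open PowerSeries in
theorem sum_jtEntry_mul_lagrangeCoeff (n r : ℕ) (k : Fin n) :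
    ∑ j : Fin n, phiInvFin n (jtEntry fallingSeries ((r : ℤ) - n) j) * lagrangeCoeff n k j =
      fallingPow (MvPolynomial.X k + MvPolynomial.C (((n - 1 - (k : ℕ) : ℕ) : ℂ))) r := by
  set f : Lam →+* MvPolynomial (Fin n) ℂ := (phiInvFin n : Lam →+* MvPolynomial (Fin n) ℂ) with hf
  set E : PowerSeries (MvPolynomial (Fin n) ℂ) :=
    ∏ l ∈ Finset.univ.erase k, (1 - C (shiftVar l) * X) with hE
  set c : ℂ →+* MvPolynomial (Fin n) ℂ := MvPolynomial.C with hc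
  set Y := map f hSeries * map c (fallingSeries ((r : ℤ) - n)) with hY
  have hE0 : ∀ m, n ≤ m → coeff m E = 0 := by
    intro m hm
    have := coeff_prod_one_add_of_lt (Finset.univ.erase k)
      (fun l => -(shiftVar l : MvPolynomial (Fin n) ℂ)) (k := m) (by
        rw [Finset.card_erase_of_mem (Finset.mem_univ k), Finset.card_univ, Fintype.card_fin]
        have := k.2
        omega)
    simpa [hE, sub_eq_add_neg] using this
  have h1 : ∀ j : Fin n, phiInvFin n (jtEntry fallingSeries ((r : ℤ) - n) j) =
      icoeff ((r : ℤ) - n + j + 1) Y := by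
    intro j
    change f _ = _
    rw [jtEntry, map_icoeff, map_mul, hY]
    congr 2
    rw [← RingHom.comp_apply, ← PowerSeries.map_comp]
    congr 2
    ext a
    simp [hf, hc]
  have h2 : ∑ j : Fin n, phiInvFin n (jtEntry fallingSeries ((r : ℤ) - n) j) *
      lagrangeCoeff n k j = coeff r (E * Y) := by
    conv_rhs => rw [eq_sum_coeff_rev hE0, Finset.sum_mul, map_sum]
    refine Finset.sum_congr rfl fun j _ => ?_
    rw [h1, mul_assoc, coeff_C_mul, ← icoeff_natCast r, icoeff_X_pow_mul, mul_comm, lagrangeCoeff]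
    congr 2
    have := j.2
    congr 1
    omega
  rw [h2]
  have hD : map c (denSeries n) = ∏ i : Fin n, (1 - C (MvPolynomial.C (shiftConst i)) * X) := by
    rw [denSeries, map_prod, Finset.prod_range]
    refine Finset.prod_congr rfl fun i _ => ?_
    rw [shiftConst]
    simp only [map_add, map_mul, map_one, map_X, map_C, hc, map_neg]
    ring
  have hinv : map c (denSeries n) * map c (denSeries n)⁻¹ = 1 := by
    rw [← map_mul, denSeries_mul_inv, map_one]
  set G := E * (map f hSeries * map c (denSeries n)⁻¹) with hG
  have hG1 : (1 - C (shiftVar k) * X) * G = 1 := by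
    rw [hG, ← mul_assoc, hE, Finset.mul_prod_erase Finset.univ
      (fun l : Fin n => 1 - C (shiftVar l : MvPolynomial (Fin n) ℂ) * X) (Finset.mem_univ k),
      ← mul_assoc, mul_comm _ (map f hSeries), hf, map_phiInvFin_hSeries_mul, ← hD, hinv]
  have h3 : E * Y = (∏ l ∈ Finset.range r,
      (1 + C (c ((n : ℂ) - 1 / 2 - l)) * X)) * G := by
    have h4 : map c (fallingSeries ((r : ℤ) - n)) * map c (denSeries n) =
        ∏ l ∈ Finset.range r, (1 + C (c ((n : ℂ) - 1 / 2 - l)) * X) := by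
      rw [← map_mul, fallingSeries_mul_denSeries, map_prod]
      refine Finset.prod_congr rfl fun l _ => ?_
      rw [map_add, map_one, map_mul, map_X, map_C]
    rw [← h4, hG, hY]
    linear_combination -(E * map f hSeries * map c (fallingSeries ((r : ℤ) - n))) * hinv
  rw [h3, coeff_prod_one_add_mul hG1 (fun l => c ((n : ℂ) - 1 / 2 - l)), fallingPow]
  refine Finset.prod_congr rfl fun l _ => ?_
  rw [shiftVar, hc, add_assoc, ← MvPolynomial.C_add, add_sub_assoc]
  congr 1
  rw [← map_natCast (MvPolynomial.C : ℂ →+* MvPolynomial (Fin n) ℂ), ← MvPolynomial.C_sub]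
  congr 1
  rw [shiftConst, Nat.sub_sub, Nat.cast_sub (by have := k.2; omega)]
  push_cast
  ring

theorem phiInvFin_jtDet_mul (n : ℕ) (μ : YoungDiagram) :
    phiInvFin n (jtDet fallingSeries n μ) * (Matrix.of (lagrangeCoeff n)).det =
      fallingDet n fun j => μ.rowLen j := by
  rw [jtDet, AlgHom.map_det, ← Matrix.det_transpose (Matrix.of (lagrangeCoeff n)), ← Matrix.det_mul,
    fallingDet, ← Matrix.det_transpose]
  congr 1
  ext1 k i
  rw [Matrix.transpose_apply, Matrix.mul_apply, Matrix.of_apply,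
    ← sum_jtEntry_mul_lagrangeCoeff]
  refine Finset.sum_congr rfl fun j _ => ?_
  rw [AlgHom.mapMatrix_apply, Matrix.map_apply, Matrix.of_apply, Matrix.transpose_apply,
    Matrix.of_apply]
  -- For r = μᵢ + n - 1 - i the row index r - n is μᵢ - (i + 1).
  congr 3
  have := i.2
  omega

theorem rowLen_bot (i : ℕ) : (⊥ : YoungDiagram).rowLen i = 0 := by
  by_contra h0
  exact YoungDiagram.notMem_bot (i, 0)
    (YoungDiagram.mem_iff_lt_rowLen.2 (Nat.pos_of_ne_zero h0))

theorem colLen_bot (i : ℕ) : (⊥ : YoungDiagram).colLen i = 0 := by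
  by_contra h0
  exact YoungDiagram.notMem_bot (0, i)
    (YoungDiagram.mem_iff_lt_colLen.2 (Nat.pos_of_ne_zero h0))

/-- The empty diagram has Jacobi–Trudi determinant 1, so the auxiliary determinant is exactly the
denominator of the shifted Schur function. -/
theorem fallingDet_zero (n : ℕ) :
    fallingDet n (fun _ => 0) = (Matrix.of (lagrangeCoeff n)).det := by
  have h := phiInvFin_jtDet_mul n ⊥
  rw [jtDet_eq_of_le _ constantCoeff_fallingSeries_negSucc (by rw [colLen_bot]; exact n.zero_le),
    colLen_bot, jtDet, Matrix.det_fin_zero, map_one, one_mul] at h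
  rw [h]
  congr 1
  ext j
  rw [rowLen_bot]

theorem fallingDet_zero_ne_zero (n : ℕ) : fallingDet n (fun _ => 0) ≠ 0 := by
  intro h
  -- At x = 0 the entries are (n-1-i)^{↓(n-1-j)}: zero for j < i, and factorials on the diagonal.
  have h1 := congrArg (MvPolynomial.eval 0) h
  rw [fallingDet, RingHom.map_det, map_zero, Matrix.det_of_isUpperTriangular] at h1
  · rw [Finset.prod_eq_zero_iff] at h1
    obtain ⟨i, -, hi⟩ := h1
    simp only [RingHom.mapMatrix_apply, Matrix.map_apply, Matrix.of_apply, fallingPow, map_prod,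
      map_sub, map_add, MvPolynomial.eval_X, map_natCast, Pi.zero_apply,
      zero_add, Finset.prod_eq_zero_iff, sub_eq_zero, Nat.cast_inj, Finset.mem_range] at hi
    obtain ⟨a, ha, ha'⟩ := hi
    omega
  · intro i j hij
    have hij' : (j : ℕ) < i := hij
    simp only [RingHom.mapMatrix_apply, Matrix.map_apply, Matrix.of_apply, fallingPow, map_prod,
      map_sub, map_add, MvPolynomial.eval_X, map_natCast, Pi.zero_apply,
      zero_add, Finset.prod_eq_zero_iff, sub_eq_zero, Nat.cast_inj, Finset.mem_range]
    exact ⟨n - 1 - (i : ℕ), by have := i.2; omega, rfl⟩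

/-- The function in `Λ` that `phiInv` sends to the shifted Schur function `s*_μ`. -/
noncomputable def jacobiTrudi (μ : YoungDiagram) : Lam := jtDet fallingSeries (μ.colLen 0) μ

theorem isShiftedSchur_phiInv (μ : YoungDiagram) : IsShiftedSchur μ (phiInv (jacobiTrudi μ)) := by
  intro n hn
  have h := phiInvFin_jtDet_mul n μ
  rw [jtDet_eq_of_le _ constantCoeff_fallingSeries_negSucc hn, ← fallingDet_zero] at h
  exact h

theorem isShiftedSchur_unique {μ : YoungDiagram} {f g : LamStar} (hf : IsShiftedSchur μ f)
    (hg : IsShiftedSchur μ g) : f = g :=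
  LamStar_ext_of_le (μ.colLen 0) fun n hn =>
    mul_right_cancel₀ (fallingDet_zero_ne_zero n) ((hf n hn).trans (hg n hn).symm)

theorem existsUnique_isShiftedSchur (μ : YoungDiagram) : ∃! f : LamStar, IsShiftedSchur μ f :=
  ⟨_, isShiftedSchur_phiInv μ, fun _ hf => isShiftedSchur_unique hf (isShiftedSchur_phiInv μ)⟩

theorem shiftedSchur_eq (μ : YoungDiagram) : shiftedSchur μ = phiInv (jacobiTrudi μ) :=
  isShiftedSchur_unique (Classical.epsilon_spec (existsUnique_isShiftedSchur μ).exists)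
    (isShiftedSchur_phiInv μ)

/-! ### The transition coefficients -/

open Polynomial in
-- Vieta's formula. Reading c_{pp'} off ∏ (X - (2i+1)/2) provides its recursions in p.
theorem c_eq_coeff (p p' : ℕ) :
    c p p' = (((Multiset.range p).map fun i : ℕ => (2 * (i : ℂ) + 1) / 2).map
      fun t => (X - C t : ℂ[X])).prod.coeff p' := by
  rw [c]
  split_ifs with h
  · rw [Multiset.prod_X_sub_C_coeff _ (by simpa using h)]
    simp
  · rw [Polynomial.coeff_eq_zero_of_natDegree_lt]
    rw [Polynomial.natDegree_multiset_prod_X_sub_C_eq_card]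
    simpa using h

theorem c_self (p : ℕ) : c p p = 1 := by
  simp [c, Multiset.esymm]

theorem c_of_lt {p p' : ℕ} (h : p < p') : c p p' = 0 := by
  rw [c, if_neg (not_le.2 h)]

theorem c_succ_zero (p : ℕ) : c (p + 1) 0 = -((p : ℂ) + 1 / 2) * c p 0 := by
  rw [c_eq_coeff, c_eq_coeff, Multiset.range_succ, Multiset.map_cons, Multiset.map_cons,
    Multiset.prod_cons, Polynomial.mul_coeff_zero]
  simp
  ring

theorem c_succ_succ (p p' : ℕ) :
    c (p + 1) (p' + 1) = c p p' - ((p : ℂ) + 1 / 2) * c p (p' + 1) := by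
  rw [c_eq_coeff, c_eq_coeff, c_eq_coeff, Multiset.range_succ, Multiset.map_cons, Multiset.map_cons,
    Multiset.prod_cons, sub_mul, Polynomial.coeff_sub, Polynomial.coeff_X_mul,
    Polynomial.coeff_C_mul]
  ring

theorem coeff_numSeries_of_lt {p k : ℕ} (h : p < k) : PowerSeries.coeff k (numSeries p) = 0 := by
  have := coeff_prod_one_add_of_lt (Finset.range p) (fun i : ℕ => -((i : ℂ) + 1 / 2)) (k := k)
    (by simpa using h)
  rw [← this, numSeries]
  congr 1
  refine Finset.prod_congr rfl fun i _ => ?_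
  rw [map_neg]
  ring

theorem coeff_numSeries (a b : ℕ) : PowerSeries.coeff b (numSeries (a + b)) = c (a + b) a := by
  obtain ⟨p, hp⟩ : ∃ p, a + b = p := ⟨_, rfl⟩
  rw [hp]
  induction p generalizing a b with
  | zero =>
    obtain rfl : a = 0 := by omega
    obtain rfl : b = 0 := by omega
    simp [numSeries, c_self]
  | succ p ih =>
    have h1 : numSeries (p + 1) = numSeries p -
        PowerSeries.C ((p : ℂ) + 1 / 2) * (PowerSeries.X * numSeries p) := by
      rw [numSeries, Finset.prod_range_succ, ← numSeries]
      ring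
    rw [h1, map_sub, PowerSeries.coeff_C_mul]
    cases b with
    | zero =>
      obtain rfl : a = p + 1 := by omega
      rw [c_self, PowerSeries.coeff_zero_X_mul, mul_zero, sub_zero,
        PowerSeries.coeff_zero_eq_constantCoeff_apply, numSeries, constantCoeff_prod_one_sub]
    | succ b =>
      rw [PowerSeries.coeff_succ_X_mul, ih a b (by omega)]
      cases a with
      | zero =>
        rw [coeff_numSeries_of_lt (by omega), c_succ_zero]
        ring
      | succ a => rw [ih a (b + 1) (by omega), c_succ_succ]

theorem numSeries_eq_sum (p : ℕ) : numSeries p =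
    ∑ p' ∈ Finset.range (p + 1), PowerSeries.C (c p p') * PowerSeries.X ^ (p - p') := by
  ext k
  rw [map_sum]
  simp only [PowerSeries.coeff_C_mul, PowerSeries.coeff_X_pow, mul_ite, mul_one, mul_zero]
  rcases Nat.lt_or_ge p k with h | h
  · rw [coeff_numSeries_of_lt h, Finset.sum_eq_zero]
    intro i _
    rw [if_neg (by omega)]
  · obtain ⟨a, rfl⟩ := Nat.exists_eq_add_of_le' h
    rw [coeff_numSeries, Finset.sum_eq_single a, if_pos (by omega)]
    · intro i hi hia
      rw [if_neg]
      have := Finset.mem_range.1 hi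
      omega
    · intro h
      exact absurd (Finset.mem_range.2 (by omega)) h

/-- Multiplying by t^(p-p') lowers the row index from p to p', so expanding the falling power in
powers of v expands the row. -/
theorem jtEntry_natCast (p j : ℕ) : jtEntry fallingSeries p j =
    ∑ p' ∈ Finset.range (p + 1), MvPolynomial.C (c p p') * jtEntry (fun _ => 1) p' j := by
  have h1 : fallingSeries (p : ℤ) = numSeries p := rfl
  rw [jtEntry, h1, numSeries_eq_sum, map_sum, Finset.mul_sum, map_sum]
  refine Finset.sum_congr rfl fun i hi => ?_
  have hi' := Finset.mem_range.1 hi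
  have h2 : PowerSeries.map (algebraMap ℂ Lam)
      (PowerSeries.C (c p i) * PowerSeries.X ^ (p - i)) =
      PowerSeries.C (MvPolynomial.C (c p i)) * PowerSeries.X ^ (p - i) := by
    simp [MvPolynomial.algebraMap_eq]
  rw [h2, mul_left_comm, icoeff_C_mul, mul_comm hSeries, icoeff_X_pow_mul, jtEntry, map_one,
    mul_one]
  congr 3
  push_cast [Nat.cast_sub (show i ≤ p by omega)]
  ring

/-! ### The isomorphism `φ` -/

theorem h_natCast (k : ℕ) : h k = PowerSeries.coeff k hSeries := by
  simp [h]

theorem jtEntry_one_zero (k : ℕ) : jtEntry (fun _ => 1) k 0 = h ((k + 1 : ℕ) : ℤ) := by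
  rw [jtEntry, map_one, mul_one, h_natCast, ← icoeff_natCast]
  push_cast
  rw [add_zero]

/-- The coefficients of `h*_k` in the `h_b`, transferred to `Λ`. -/
noncomputable def rowCoeff : ℕ → ℕ → ℂ
  | 0, 0 => 1
  | 0, _ + 1 => 0
  | _ + 1, 0 => 0
  | k + 1, b + 1 => c k b

theorem rowCoeff_zero_left (b : ℕ) : rowCoeff 0 b = c 0 b := by
  cases b with
  | zero => exact (c_self 0).symm
  | succ b => exact (c_of_lt b.succ_pos).symm

/-- The recursion of c absorbs the separate cases of `rowCoeff` into one formula, the one that makes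
the sums below telescope. -/
theorem rowCoeff_succ_left (k b : ℕ) :
    rowCoeff (k + 1) b = c (k + 1) b + ((k : ℂ) + 1 / 2) * c k b := by
  cases b with
  | zero =>
    rw [c_succ_zero, rowCoeff]
    ring
  | succ b =>
    rw [c_succ_succ, rowCoeff]
    ring

theorem rowCoeff_of_lt {k b : ℕ} (h : k < b) : rowCoeff k b = 0 := by
  rcases k with _ | k
  · rw [rowCoeff_zero_left, c_of_lt h]
  · rw [rowCoeff_succ_left, c_of_lt h, c_of_lt (by omega)]
    ring

theorem mem_rowDiagram {k : ℕ} {x : ℕ × ℕ} : x ∈ rowDiagram k ↔ x.1 = 0 ∧ x.2 < k := by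
  rw [rowDiagram, YoungDiagram.mem_ofRowLens]
  constructor
  · rintro ⟨h1, h2⟩
    simp only [List.length_singleton, Nat.lt_one_iff] at h1
    refine ⟨h1, ?_⟩
    simpa [h1] using h2
  · rintro ⟨h1, h2⟩
    refine ⟨by simp [h1], by simpa [h1] using h2⟩

theorem rowLen_rowDiagram (k : ℕ) : (rowDiagram k).rowLen 0 = k := by
  refine le_antisymm ?_ ?_
  · by_contra! h
    exact lt_irrefl k (mem_rowDiagram.1 (YoungDiagram.mem_iff_lt_rowLen.2 h)).2
  · by_contra! h
    exact lt_irrefl _ (YoungDiagram.mem_iff_lt_rowLen.1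
      (mem_rowDiagram.2 ⟨rfl, h⟩ : (0, (rowDiagram k).rowLen 0) ∈ rowDiagram k))

theorem colLen_rowDiagram_le (k : ℕ) : (rowDiagram k).colLen 0 ≤ 1 := by
  by_contra! h
  exact absurd (mem_rowDiagram.1 (YoungDiagram.mem_iff_lt_colLen.2 h)).1 one_ne_zero

theorem jacobiTrudi_rowDiagram (k : ℕ) : jacobiTrudi (rowDiagram k) =
    ∑ b ∈ Finset.range (k + 1), rowCoeff k b • h b := by
  rw [jacobiTrudi, ← jtDet_eq_of_le _ constantCoeff_fallingSeries_negSucc (colLen_rowDiagram_le k),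
    jtDet, Matrix.det_fin_one, Matrix.of_apply, Fin.val_zero, rowLen_rowDiagram]
  cases k with
  | zero =>
    have h1 : ((0 : ℕ) : ℤ) - ((0 : ℕ) + 1) = Int.negSucc 0 := rfl
    rw [h1, jtEntry_negSucc_self _ _ (constantCoeff_fallingSeries_negSucc 0)]
    rw [Finset.sum_range_one, h_natCast, PowerSeries.coeff_zero_eq_constantCoeff_apply,
      constantCoeff_hSeries, rowCoeff, one_smul]
  | succ k =>
    have h1 : ((k + 1 : ℕ) : ℤ) - ((0 : ℕ) + 1) = k := by push_cast; ring
    have h2 : rowCoeff (k + 1) 0 = 0 := rfl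
    rw [h1, jtEntry_natCast, Finset.sum_range_succ' _ (k + 1), h2, zero_smul, add_zero]
    refine Finset.sum_congr rfl fun b _ => ?_
    rw [jtEntry_one_zero, rowCoeff, MvPolynomial.smul_eq_C_mul]

/-! ### Powers of 1/(u + 1/2) in inverse falling powers, and uniqueness of `φ` -/

section expansions

open PowerSeries

theorem invFallingPow_succ_mul (k : ℕ) :
    invFallingPow (k + 1) * (1 - C (k : ℂ) * X) = X * invFallingPow k := by
  have h1 : (1 - C (k : ℂ) * X : PowerSeries ℂ) * (1 - C (k : ℂ) * X)⁻¹ = 1 :=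
    PowerSeries.mul_inv_cancel _ (by simp)
  rw [invFallingPow, Finset.prod_range_succ, ← invFallingPow]
  linear_combination (invFallingPow k * X) * h1

theorem X_pow_dvd_invFallingPow (k : ℕ) : X ^ k ∣ invFallingPow k := by
  rw [invFallingPow, Finset.prod_mul_distrib, Finset.prod_const, Finset.card_range]
  exact dvd_mul_right _ _

/-- The truncated form of the passage from b to b + 1, that is, of dividing by u + 1/2. The boundary
term c_{Nb}/u^{↓N} is what makes it exact and lets the induction on N close. -/
theorem sum_rowCoeff_mul_invFallingPow (N b : ℕ) :
    (1 + C (1 / 2 : ℂ) * X) *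
        ∑ k ∈ Finset.range (N + 1), C (rowCoeff k (b + 1)) * invFallingPow k =
      X * (∑ k ∈ Finset.range (N + 1), C (rowCoeff k b) * invFallingPow k -
        C (c N b) * invFallingPow N) := by
  induction N with
  | zero =>
    simp only [zero_add, Finset.sum_range_one, rowCoeff_zero_left, c_of_lt b.succ_pos]
    simp
  | succ N ih =>
    have h1 := invFallingPow_succ_mul N
    rw [Finset.sum_range_succ, mul_add, ih, Finset.sum_range_succ _ (N + 1), rowCoeff,
      rowCoeff_succ_left, map_add, map_mul, map_add]
    linear_combination C (c N b) * h1

/-- The expansion 1/(u + 1/2)ᵇ = ∑ₖ `rowCoeff k b`/u^{↓k} as a congruence, by induction on b: the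
boundary term of the truncated identity is divisible by a high enough power of t. -/
theorem X_pow_dvd_sum_sub_invHalfShiftPow (N b : ℕ) :
    X ^ N ∣ ∑ k ∈ Finset.range N, C (rowCoeff k b) * invFallingPow k - invHalfShiftPow b := by
  cases N with
  | zero => simp
  | succ N =>
  induction b with
  | zero =>
    rw [Finset.sum_range_succ']
    simp [rowCoeff, invHalfShiftPow, invFallingPow]
  | succ b ih =>
    have h1 : (1 + C (1 / 2 : ℂ) * X : PowerSeries ℂ) * (1 + C (1 / 2 : ℂ) * X)⁻¹ = 1 :=
      PowerSeries.mul_inv_cancel _ (by simp)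
    have h2 := sum_rowCoeff_mul_invFallingPow N b
    have h3 : ∑ k ∈ Finset.range (N + 1), C (rowCoeff k (b + 1)) * invFallingPow k -
        invHalfShiftPow (b + 1) =
        (1 + C (1 / 2 : ℂ) * X)⁻¹ * (X * (∑ k ∈ Finset.range (N + 1),
          C (rowCoeff k b) * invFallingPow k - invHalfShiftPow b) -
          C (c N b) * (X * invFallingPow N)) := by
      rw [invHalfShiftPow, pow_succ, ← invHalfShiftPow]
      linear_combination (1 + C (1 / 2 : ℂ) * X)⁻¹ * h2 -
        (∑ k ∈ Finset.range (N + 1), C (rowCoeff k (b + 1)) * invFallingPow k) * h1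
    rw [h3]
    refine Dvd.dvd.mul_left (dvd_sub (ih.mul_left _) (Dvd.dvd.mul_left ?_ _)) _
    rw [pow_succ']
    exact mul_dvd_mul_left _ (X_pow_dvd_invFallingPow N)

theorem expandSeries_jacobiTrudi :
    expandSeries invFallingPow (fun k => jacobiTrudi (rowDiagram k)) = HHalfShift := by
  ext1 n
  rw [HHalfShift, expandSeries, expandSeries, coeff_mk, coeff_mk]
  have h1 : ∀ b, coeff n (invHalfShiftPow b) =
      ∑ k ∈ Finset.range (n + 1), rowCoeff k b * coeff n (invFallingPow k) := by
    intro b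
    have := X_pow_dvd_iff.1 (X_pow_dvd_sum_sub_invHalfShiftPow (n + 1) b) n n.lt_succ_self
    rw [map_sub, sub_eq_zero, map_sum] at this
    rw [← this]
    exact Finset.sum_congr rfl fun k _ => coeff_C_mul _ _ _
  have h2 : ∀ k ∈ Finset.range (n + 1),
      coeff n (invFallingPow k) • jacobiTrudi (rowDiagram k) =
        ∑ b ∈ Finset.range (n + 1), (rowCoeff k b * coeff n (invFallingPow k)) • h b := by
    intro k hk
    have hk' := Finset.mem_range.1 hk
    rw [jacobiTrudi_rowDiagram, Finset.smul_sum]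
    rw [Finset.sum_subset (Finset.range_subset_range.2 (show k + 1 ≤ n + 1 by omega))]
    · refine Finset.sum_congr rfl fun b _ => ?_
      rw [smul_smul, mul_comm]
    · intro b _ hb
      rw [rowCoeff_of_lt (by simpa using hb), zero_smul, smul_zero]
  rw [Finset.sum_congr rfl h2, Finset.sum_comm]
  refine Finset.sum_congr rfl fun b _ => ?_
  rw [h1, Finset.sum_smul]

theorem map_expandSeries {A B : Type*} [CommRing A] [Algebra ℂ A] [CommRing B] [Algebra ℂ B]
    (f : A →ₐ[ℂ] B) (g : ℕ → PowerSeries ℂ) (a : ℕ → A) :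
    map (f : A →+* B) (expandSeries g a) = expandSeries g fun k => f (a k) := by
  ext n
  simp [expandSeries]

theorem coeff_invHalfShiftPow_self (n : ℕ) : coeff n (invHalfShiftPow n) = 1 := by
  rw [invHalfShiftPow, mul_pow, coeff_X_pow_mul', if_pos le_rfl, Nat.sub_self,
    coeff_zero_eq_constantCoeff_apply]
  simp

/-- The family is unitriangular with respect to powers of t, so the coefficients are recovered one
at a time. -/
theorem expandSeries_invHalfShiftPow_injective {A : Type*} [CommRing A] [Algebra ℂ A]
    {a b : ℕ → A} (hab : expandSeries invHalfShiftPow a = expandSeries invHalfShiftPow b) :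
    a = b := by
  funext n
  induction n using Nat.strong_induction_on with
  | _ n ih =>
    have h1 := congrArg (coeff n) hab
    rw [expandSeries, expandSeries, coeff_mk, coeff_mk, Finset.sum_range_succ,
      Finset.sum_range_succ, coeff_invHalfShiftPow_self, one_smul, one_smul] at h1
    rw [Finset.sum_congr rfl fun k hk => by rw [ih k (Finset.mem_range.1 hk)]] at h1
    exact add_left_cancel h1

theorem HStar_eq : HStar = map (phiInv : Lam →+* LamStar) HHalfShift := by
  rw [← expandSeries_jacobiTrudi, map_expandSeries, HStar]
  congr 1
  funext k
  rw [hStar, shiftedSchur_eq]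

theorem isPhi_symm : IsPhi (phiInvEquiv.symm : LamStar →ₐ[ℂ] Lam) := by
  refine ⟨phiInvEquiv.symm.bijective, ?_⟩
  rw [HStar_eq, ← RingHom.comp_apply, ← PowerSeries.map_comp]
  have : ((phiInvEquiv.symm : LamStar →ₐ[ℂ] Lam) : LamStar →+* Lam).comp
      (phiInv : Lam →+* LamStar) = RingHom.id Lam :=
    RingHom.ext fun x => phiInvEquiv.symm_apply_apply x
  rw [this, PowerSeries.map_id, id_eq]

/-- Comparing expansions in powers of 1/(u + 1/2) shows that φ ∘ `phiInv` fixes every h_k. By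
Newton's recursion it fixes the power sums, hence everything. -/
theorem eq_symm_of_isPhi {φ : LamStar →ₐ[ℂ] Lam} (hφ : IsPhi φ) :
    φ = (phiInvEquiv.symm : LamStar →ₐ[ℂ] Lam) := by
  have h1 := hφ.2
  rw [HStar_eq, ← RingHom.comp_apply, ← PowerSeries.map_comp] at h1
  have h2 : (φ : LamStar →+* Lam).comp (phiInv : Lam →+* LamStar) =
      ((φ.comp phiInv : Lam →ₐ[ℂ] Lam) : Lam →+* Lam) := rfl
  rw [h2, HHalfShift, map_expandSeries] at h1
  have h3 := expandSeries_invHalfShiftPow_injective h1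
  have h4 : φ.comp phiInv = AlgHom.id ℂ Lam := by
    ext1 k
    refine map_X_eq_of_map_hSeries_eq (φ.comp phiInv : Lam →+* Lam) (RingHom.id Lam) k
      (fun i _ => ?_) k le_rfl
    have := congrFun h3 i
    rw [h_natCast] at this
    exact this
  ext1 f
  obtain ⟨Q, rfl⟩ := phiInv_surjective f
  have h5 := DFunLike.congr_fun h4 Q
  refine h5.trans ?_
  exact (phiInvEquiv.symm_apply_apply Q).symm

theorem existsUnique_isPhi : ∃! φ : LamStar →ₐ[ℂ] Lam, IsPhi φ :=
  ⟨_, isPhi_symm, fun _ hφ => eq_symm_of_isPhi hφ⟩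

theorem Fs_eq_jacobiTrudi (μ : YoungDiagram) : Fs μ = jacobiTrudi μ := by
  have h1 : phi = (phiInvEquiv.symm : LamStar →ₐ[ℂ] Lam) :=
    eq_symm_of_isPhi (Classical.epsilon_spec existsUnique_isPhi.exists)
  rw [Fs, shiftedSchur_eq, h1]
  exact phiInvEquiv.symm_apply_apply _

end expansions

/-! ### The Cauchy–Binet formula -/

section CauchyBinet

variable {R ι : Type*} [CommRing R] [Fintype ι] {d : ℕ}

/-- Multilinearity of the determinant in the rows of the product. -/
theorem det_mul_eq_sum_prod_mul_det (A : Matrix (Fin d) ι R) (B : Matrix ι (Fin d) R) :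
    (A * B).det = ∑ f : Fin d → ι, (∏ i, A i (f i)) * (B.submatrix f id).det := by
  classical
  have h1 : A * B = fun i => ∑ k, A i k • B k := by
    ext i j
    simp [Matrix.mul_apply]
  change Matrix.detRowAlternating (A * B) = _
  rw [h1, ← AlternatingMap.coe_multilinearMap, MultilinearMap.map_sum]
  refine Finset.sum_congr rfl fun f _ => ?_
  rw [MultilinearMap.map_smul_univ, smul_eq_mul]
  rfl

variable [LinearOrder ι]

-- Families with a repeated index contribute zero. An injective family is uniquely a permutation of
-- its sorted version, and summing over the permutations assembles the minor of A.
open Classical in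
theorem det_mul_eq_sum_strictMono (A : Matrix (Fin d) ι R) (B : Matrix ι (Fin d) R) :
    (A * B).det = ∑ f : Fin d → ι with StrictMono f,
      (A.submatrix id f).det * (B.submatrix f id).det := by
  rw [det_mul_eq_sum_prod_mul_det]
  have h1 : ∀ f : Fin d → ι, (A.submatrix id f).det * (B.submatrix f id).det =
      ∑ σ : Equiv.Perm (Fin d), (∏ i, A i (f (σ i))) * (B.submatrix (f ∘ σ) id).det := by
    intro f
    have h2 : ∀ σ : Equiv.Perm (Fin d), (B.submatrix (f ∘ σ) id).det =
        (Equiv.Perm.sign σ : ℤ) * (B.submatrix f id).det := by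
      intro σ
      rw [← Matrix.det_permute]
      rfl
    rw [← Matrix.det_transpose, Matrix.det_apply', Finset.sum_mul]
    refine Finset.sum_congr rfl fun σ _ => ?_
    rw [h2]
    simp only [Matrix.transpose_apply, Matrix.submatrix_apply, id_eq]
    ring
  rw [Finset.sum_congr rfl fun f _ => h1 f, ← Finset.sum_product']
  symm
  refine Finset.sum_of_injOn (fun x : (Fin d → ι) × Equiv.Perm (Fin d) => x.1 ∘ x.2) ?_ ?_ ?_ ?_
  · rintro ⟨f, σ⟩ hf ⟨g, τ⟩ hg hfg
    have hf' : StrictMono f := by simpa using hf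
    have hg' : StrictMono g := by simpa using hg
    have h3 : f ∘ σ = g ∘ τ := hfg
    have h4 : Set.range f = Set.range g := by
      rw [← σ.surjective.range_comp f, ← τ.surjective.range_comp g, h3]
    have h5 : f = g := (hf'.range_inj hg').1 h4
    subst h5
    refine Prod.ext rfl (Equiv.ext fun i => hf'.injective (congrFun h3 i))
  · intro x _
    exact Finset.mem_coe.2 (Finset.mem_univ _)
  · intro f _ hf
    by_cases hinj : Function.Injective f
    · exfalso
      apply hf
      have hcard : (Finset.univ.image f).card = d := by
        rw [Finset.card_image_of_injective _ hinj, Finset.card_univ, Fintype.card_fin]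
      set g := (Finset.univ.image f).orderEmbOfFin hcard with hg
      have h3 : ∀ i, ∃ j, g j = f i := by
        intro i
        have : f i ∈ Set.range g := by
          rw [hg, Finset.range_orderEmbOfFin]
          simp
        exact this
      choose s hs using h3
      have hs' : Function.Injective s := fun i j hij => hinj (by rw [← hs, ← hs, hij])
      refine ⟨(g, Equiv.ofBijective s (Finite.injective_iff_bijective.1 hs')), ?_, ?_⟩
      · simpa using g.strictMono
      · funext i
        exact hs i
    · obtain ⟨i, j, hij, hne⟩ : ∃ i j, f i = f j ∧ i ≠ j := by
        simpa [Function.Injective] using hinj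
      rw [Matrix.det_zero_of_row_eq hne (by ext k; simp [hij]), mul_zero]
  · intro x _
    rfl

open Classical in
/-- The Cauchy–Binet formula, as a sum over decreasing families of indices. -/
theorem det_mul_eq_sum_strictAnti (A : Matrix (Fin d) ι R) (B : Matrix ι (Fin d) R) :
    (A * B).det = ∑ f : Fin d → ι with StrictAnti f,
      (A.submatrix id f).det * (B.submatrix f id).det := by
  have h := det_mul_eq_sum_strictMono (ι := ιᵒᵈ) A B
  refine h.trans (Finset.sum_equiv (Equiv.refl _) (fun f => ?_) fun f _ => rfl)
  simp only [Finset.mem_filter, Finset.mem_univ, true_and]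
  rfl

end CauchyBinet

/-- A square matrix with a zero block meeting the diagonal at `(k, k)` and containing the lower
left corner has determinant zero. -/
theorem det_eq_zero_of_forall_le {R : Type*} [CommRing R] {d : ℕ} (A : Matrix (Fin d) (Fin d) R)
    (k : Fin d) (hA : ∀ i j, k ≤ i → j ≤ k → A i j = 0) : A.det = 0 := by
  rw [Matrix.det_apply]
  refine Finset.sum_eq_zero fun σ _ => ?_
  -- Pigeonhole: σ cannot send the k + 1 indices up to k into the k indices below k.
  obtain ⟨j, hj, hσ⟩ : ∃ j ≤ k, k ≤ σ j := by
    by_contra! hcon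
    have h1 : (Finset.Iic k).image σ ⊆ Finset.Iio k := by
      intro x hx
      obtain ⟨j, hj, rfl⟩ := Finset.mem_image.1 hx
      exact Finset.mem_Iio.2 (hcon j (Finset.mem_Iic.1 hj))
    have h2 := Finset.card_le_card h1
    rw [Finset.card_image_of_injective _ σ.injective, Fin.card_Iic, Fin.card_Iio] at h2
    omega
  have h0 : ∏ i, A (σ i) i = 0 := Finset.prod_eq_zero (Finset.mem_univ j) (hA _ _ hσ hj)
  rw [h0, smul_zero]

/-! ### Change of the family of series -/

/-- Upper triangular Toeplitz matrices multiply like power series. Cutting off at n loses nothing,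
since terms with k > b vanish. -/
theorem sum_icoeff_mul_icoeff {A : Type*} [CommRing A] (F K : PowerSeries A) {n : ℕ} (a : ℕ)
    {b : ℕ} (hb : b < n) :
    ∑ k : Fin n, icoeff ((k : ℤ) - a) F * icoeff ((b : ℤ) - k) K =
      icoeff ((b : ℤ) - a) (F * K) := by
  rw [Fin.sum_univ_eq_sum_range fun k : ℕ => icoeff ((k : ℤ) - a) F * icoeff ((b : ℤ) - k) K]
  rcases Nat.lt_or_ge b a with h | h
  · rw [icoeff_of_neg (by omega)]
    refine Finset.sum_eq_zero fun k _ => ?_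
    rcases Nat.lt_or_ge k a with h1 | h1
    · rw [icoeff_of_neg (by omega), zero_mul]
    · rw [icoeff_of_neg (k := (b : ℤ) - k) (by omega), mul_zero]
  · obtain ⟨e, rfl⟩ := Nat.exists_eq_add_of_le h
    have h1 : ((a + e : ℕ) : ℤ) - a = (e : ℕ) := by push_cast; ring
    rw [h1, icoeff_natCast, PowerSeries.coeff_mul, Finset.Nat.sum_antidiagonal_eq_sum_range_succ_mk]
    symm
    refine Finset.sum_of_injOn (fun i => a + i) (fun i _ j _ hij => by simpa using hij) ?_ ?_ ?_
    · intro i hi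
      have := Finset.mem_range.1 (Finset.mem_coe.1 hi)
      exact Finset.mem_coe.2 (Finset.mem_range.2 (show a + i < n by omega))
    · intro k _ hk
      rcases Nat.lt_or_ge k a with h2 | h2
      · rw [icoeff_of_neg (by omega), zero_mul]
      · rw [icoeff_of_neg (k := ((a + e : ℕ) : ℤ) - k), mul_zero]
        by_contra h3
        exact hk ⟨k - a, Finset.mem_coe.2 (Finset.mem_range.2 (by omega)), by simp only; omega⟩
    · intro i hi
      have hi' := Finset.mem_range.1 hi
      have h2 : ((a + i : ℕ) : ℤ) - a = (i : ℕ) := by push_cast; ring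
      have h3 : ((a + e : ℕ) : ℤ) - (a + i : ℕ) = (e - i : ℕ) := by omega
      rw [h2, h3, icoeff_natCast, icoeff_natCast]

theorem coeff_denSeries (a k : ℕ) :
    PowerSeries.coeff k (denSeries (a + k)) = (-1) ^ k * c (a + k) a := by
  have h1 : denSeries (a + k) = PowerSeries.rescale (-1) (numSeries (a + k)) := by
    rw [denSeries, numSeries, map_prod]
    refine Finset.prod_congr rfl fun i _ => ?_
    have h2 : PowerSeries.rescale (-1 : ℂ) (PowerSeries.C ((i : ℂ) + 1 / 2)) =
        PowerSeries.C ((i : ℂ) + 1 / 2) := by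
      ext k
      rw [PowerSeries.coeff_rescale, PowerSeries.coeff_C]
      split_ifs with hk
      · rw [hk, pow_zero, one_mul]
      · rw [mul_zero]
    rw [map_sub, map_one, map_mul, h2, PowerSeries.rescale_neg_one_X]
    ring
  rw [h1, PowerSeries.coeff_rescale, coeff_numSeries]

theorem icoeff_denSeries (a b : ℕ) :
    icoeff ((a : ℤ) - b) (denSeries a) = (-1) ^ a * (-1) ^ b * c a b := by
  rcases Nat.lt_or_ge a b with h | h
  · rw [icoeff_of_neg (by omega), c_of_lt h, mul_zero]
  · obtain ⟨k, rfl⟩ := Nat.exists_eq_add_of_le h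
    have h1 : ((b + k : ℕ) : ℤ) - b = (k : ℕ) := by push_cast; ring
    rw [h1, icoeff_natCast, coeff_denSeries, pow_add]
    have h2 : ((-1 : ℂ) ^ b) * (-1) ^ b = 1 := by rw [← mul_pow]; simp
    linear_combination (-(-1) ^ k * c (b + k) b) * h2

/-- For b > a the quotient is a product of only b - a - 1 linear factors, so its coefficient in
degree b - a is zero. -/
theorem icoeff_inv_denSeries_mul (a b : ℕ) :
    icoeff ((b : ℤ) - a) ((denSeries (a + 1))⁻¹ * denSeries b) = if a = b then 1 else 0 := by
  rcases lt_trichotomy b a with h | h | h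
  · rw [icoeff_of_neg (by omega), if_neg (by omega)]
  · subst h
    rw [sub_self, if_pos rfl, ← Nat.cast_zero, icoeff_natCast,
      PowerSeries.coeff_zero_eq_constantCoeff_apply, map_mul, constantCoeff_denSeries,
      PowerSeries.constantCoeff_inv, constantCoeff_denSeries]
    simp
  · have h1 : denSeries b = denSeries (a + 1) * ∏ i ∈ Finset.Ico (a + 1) b,
        (1 + PowerSeries.C ((i : ℂ) + 1 / 2) * PowerSeries.X) :=
      (Finset.prod_range_mul_prod_Ico _ (by omega)).symm
    rw [h1, ← mul_assoc, mul_comm _ (denSeries (a + 1)), denSeries_mul_inv, one_mul,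
      if_neg (by omega), ← Nat.cast_sub h.le, icoeff_natCast, coeff_prod_one_add_of_lt]
    rw [Nat.card_Ico]
    omega

/-- The rows of negative index of the Jacobi–Trudi matrix. -/
noncomputable def negRows (g : ℤ → PowerSeries ℂ) (n : ℕ) : Matrix (Fin n) (Fin n) Lam :=
  Matrix.of fun a j => jtEntry g (Int.negSucc a) j

/-- The rows of nonnegative index of the Jacobi–Trudi matrix. -/
noncomputable def posRows (g : ℤ → PowerSeries ℂ) (n : ℕ) : Matrix (Fin n) (Fin n) Lam :=
  Matrix.of fun p j => jtEntry g (p : ℕ) j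

theorem det_negRows (g : ℤ → PowerSeries ℂ)
    (hg : ∀ a, PowerSeries.constantCoeff (g (Int.negSucc a)) = 1) (n : ℕ) :
    (negRows g n).det = 1 := by
  rw [Matrix.det_of_isUpperTriangular]
  · exact Finset.prod_eq_one fun a _ => jtEntry_negSucc_self g a (hg a)
  · intro i j hij
    exact jtEntry_negSucc_of_lt g hij

/-- The signs `(-1)^q`, as a diagonal matrix. -/
noncomputable def signMatrix (n : ℕ) : Matrix (Fin n) (Fin n) Lam :=
  Matrix.diagonal fun q => (-1) ^ (q : ℕ)

/-- The matrix whose `(p, q)` entry is the Jacobi–Trudi determinant of the hook with Frobenius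
coordinates `(p | q)`. -/
noncomputable def hookMatrix (g : ℤ → PowerSeries ℂ) (n : ℕ) : Matrix (Fin n) (Fin n) Lam :=
  posRows g n * (negRows g n)⁻¹ * signMatrix n

/-- The matrix of the coefficients `c_{pp'}`. -/
noncomputable def cMatrix (n : ℕ) : Matrix (Fin n) (Fin n) Lam :=
  Matrix.of fun p p' => MvPolynomial.C (c p p')

theorem posRows_fallingSeries (n : ℕ) :
    posRows fallingSeries n = cMatrix n * posRows (fun _ => 1) n := by
  ext1 p j
  rw [posRows, Matrix.of_apply, jtEntry_natCast, Matrix.mul_apply]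
  simp only [cMatrix, posRows, Matrix.of_apply]
  rw [Fin.sum_univ_eq_sum_range fun k : ℕ =>
    (MvPolynomial.C (c p k) : Lam) * jtEntry (fun _ => 1) k j]
  refine Finset.sum_subset (Finset.range_subset_range.2 p.2) fun k _ hk => ?_
  rw [c_of_lt (by simpa using hk), map_zero, zero_mul]

/-- The matrix expressing the rows of negative index for `fallingSeries` in the ordinary ones. -/
noncomputable def negTransition (n : ℕ) : Matrix (Fin n) (Fin n) Lam :=
  Matrix.of fun a b => MvPolynomial.C (icoeff (((b : ℕ) : ℤ) - (a : ℕ)) (denSeries (a + 1))⁻¹)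

theorem negRows_fallingSeries (n : ℕ) :
    negRows fallingSeries n = negTransition n * negRows (fun _ => 1) n := by
  ext1 a j
  rw [negRows, Matrix.of_apply, jtEntry_negSucc, Matrix.mul_apply, mul_comm,
    ← sum_icoeff_mul_icoeff _ _ a j.2]
  refine Finset.sum_congr rfl fun b _ => ?_
  rw [negTransition, Matrix.of_apply, negRows, Matrix.of_apply, jtEntry_negSucc, map_one, mul_one,
    ← map_icoeff]
  rfl

theorem signMatrix_mul_self (n : ℕ) : signMatrix n * signMatrix n = 1 := by
  rw [signMatrix, Matrix.diagonal_mul_diagonal, ← Matrix.diagonal_one]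
  congr 1
  funext q
  rw [← mul_pow]
  simp

/-- Up to signs, column b of Cᵀ holds the coefficients of `denSeries b`. The product with the
inverse series is then a single coefficient of `denSeries b / denSeries (a + 1)`. -/
theorem negTransition_mul (n : ℕ) :
    negTransition n * (signMatrix n * (cMatrix n).transpose * signMatrix n) = 1 := by
  ext1 a b
  have h1 : ∀ k : Fin n, (signMatrix n * (cMatrix n).transpose * signMatrix n) k b =
      MvPolynomial.C (icoeff (((b : ℕ) : ℤ) - (k : ℕ)) (denSeries b)) := by
    intro k
    rw [icoeff_denSeries, signMatrix, Matrix.mul_diagonal, Matrix.diagonal_mul,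
      Matrix.transpose_apply, cMatrix, Matrix.of_apply]
    simp only [map_mul, map_pow, map_neg, map_one]
    ring
  rw [Matrix.mul_apply]
  simp only [h1, negTransition, Matrix.of_apply, ← map_mul, ← map_sum]
  rw [Matrix.one_apply]
  have h2 : ∑ k : Fin n, icoeff (((k : ℕ) : ℤ) - (a : ℕ)) (denSeries (a + 1))⁻¹ *
      icoeff (((b : ℕ) : ℤ) - (k : ℕ)) (denSeries b) = if (a : ℕ) = b then 1 else 0 := by
    rw [sum_icoeff_mul_icoeff _ _ (a : ℕ) b.2, icoeff_inv_denSeries_mul]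
  rw [h2]
  simp only [Fin.ext_iff]
  split_ifs <;> simp

/-- C enters on the left through the nonnegative rows, and Cᵀ on the right through the inverse of
the negative rows; the sign matrix in the definition cancels the signs around Cᵀ. On single entries
this is the theorem for hooks. -/
theorem hookMatrix_fallingSeries (n : ℕ) : hookMatrix fallingSeries n =
    cMatrix n * hookMatrix (fun _ => 1) n * (cMatrix n).transpose := by
  have h1 : (negRows fallingSeries n)⁻¹ = (negRows (fun _ => 1) n)⁻¹ *
      (signMatrix n * (cMatrix n).transpose * signMatrix n) := by
    refine Matrix.inv_eq_right_inv ?_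
    have h2 : negRows (fun _ => 1) n * (negRows (fun _ => 1) n)⁻¹ = 1 :=
      Matrix.mul_nonsing_inv _ (by
        rw [det_negRows _ (fun _ => map_one _)]
        exact isUnit_one)
    rw [negRows_fallingSeries, Matrix.mul_assoc, ← Matrix.mul_assoc (negRows _ n), h2,
      Matrix.one_mul, negTransition_mul]
  rw [hookMatrix, hookMatrix, posRows_fallingSeries, h1]
  simp only [Matrix.mul_assoc]
  rw [signMatrix_mul_self, Matrix.mul_one]

/-! ### Frobenius coordinates -/

/-- The diagonal squares form an initial segment, so their number decides membership. -/
theorem lt_depth_iff {μ : YoungDiagram} {i : ℕ} : i < depth μ ↔ (i, i) ∈ μ := by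
  set S := (μ.cells.filter fun x => x.1 = x.2).image Prod.fst with hS
  have hmem : ∀ j, j ∈ S ↔ (j, j) ∈ μ := by
    intro j
    simp [hS]
  have hcard : S.card = depth μ := by
    rw [hS, Finset.card_image_of_injOn, depth]
    rintro ⟨a, b⟩ hx ⟨a', b'⟩ hy hxy
    have h1 : a = b := (Finset.mem_filter.1 (Finset.mem_coe.1 hx)).2
    have h2 : a' = b' := (Finset.mem_filter.1 (Finset.mem_coe.1 hy)).2
    have h3 : a = a' := hxy
    subst h1 h2 h3
    rfl
  rw [← hcard, ← hmem]
  constructor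
  · intro hi
    by_contra hiS
    have h1 : S ⊆ Finset.range i := by
      intro j hj
      rw [Finset.mem_range]
      by_contra hji
      exact hiS ((hmem i).2 (μ.up_left_mem (not_lt.1 hji) (not_lt.1 hji) ((hmem j).1 hj)))
    have h2 := Finset.card_le_card h1
    rw [Finset.card_range] at h2
    omega
  · intro hi
    have h1 : Finset.range (i + 1) ⊆ S := by
      intro j hj
      have hj' : j ≤ i := Nat.lt_succ_iff.1 (Finset.mem_range.1 hj)
      exact (hmem j).2 (μ.up_left_mem hj' hj' ((hmem i).1 hi))
    have h2 := Finset.card_le_card h1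
    rw [Finset.card_range] at h2
    omega

theorem lt_depth_iff_lt_rowLen {μ : YoungDiagram} {i : ℕ} : i < depth μ ↔ i < μ.rowLen i :=
  lt_depth_iff.trans YoungDiagram.mem_iff_lt_rowLen

theorem lt_depth_iff_lt_colLen {μ : YoungDiagram} {i : ℕ} : i < depth μ ↔ i < μ.colLen i :=
  lt_depth_iff.trans YoungDiagram.mem_iff_lt_colLen

theorem depth_le_colLen (μ : YoungDiagram) : depth μ ≤ μ.colLen 0 := by
  by_contra! h
  have h1 := lt_depth_iff_lt_colLen.1 h
  have h2 := μ.colLen_anti 0 (μ.colLen 0) (Nat.zero_le _)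
  omega

theorem frobP_lt_frobP {μ : YoungDiagram} {i j : ℕ} (hij : i < j) (hj : j < depth μ) :
    frobP μ j < frobP μ i := by
  have h1 := lt_depth_iff_lt_rowLen.1 hj
  have h2 := μ.rowLen_anti i j hij.le
  unfold frobP
  omega

theorem frobQ_lt_frobQ {μ : YoungDiagram} {i j : ℕ} (hij : i < j) (hj : j < depth μ) :
    frobQ μ j < frobQ μ i := by
  have h1 := lt_depth_iff_lt_colLen.1 hj
  have h2 := μ.colLen_anti i j hij.le
  unfold frobQ
  omega

theorem mem_iff_frob {μ : YoungDiagram} {i j : ℕ} : (i, j) ∈ μ ↔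
    (i < depth μ ∧ i ≤ j ∧ j ≤ i + frobP μ i) ∨ (j < depth μ ∧ j ≤ i ∧ i ≤ j + frobQ μ j) := by
  unfold frobP frobQ
  constructor
  · intro h
    have hr := YoungDiagram.mem_iff_lt_rowLen.1 h
    have hc := YoungDiagram.mem_iff_lt_colLen.1 h
    rcases le_total i j with hij | hij
    · have h1 : i < depth μ := lt_depth_iff.2 (μ.up_left_mem le_rfl hij h)
      exact Or.inl ⟨h1, hij, by omega⟩
    · have h1 : j < depth μ := lt_depth_iff.2 (μ.up_left_mem hij le_rfl h)
      exact Or.inr ⟨h1, hij, by omega⟩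
  · rintro (⟨h1, h2, h3⟩ | ⟨h1, h2, h3⟩)
    · have := lt_depth_iff_lt_rowLen.1 h1
      exact YoungDiagram.mem_iff_lt_rowLen.2 (by omega)
    · have := lt_depth_iff_lt_colLen.1 h1
      exact YoungDiagram.mem_iff_lt_colLen.2 (by omega)

/-- A strictly decreasing sequence of naturals drops by at least one at each step. This makes hooks
stacked along the diagonal nest into a Young diagram. -/
theorem strictAnti_add_le {d : ℕ} {f : Fin d → ℕ} (hf : StrictAnti f) {i j : Fin d} (hij : i ≤ j) :
    f j + ((j : ℕ) - i) ≤ f i := by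
  obtain ⟨i, hi⟩ := i
  obtain ⟨j, hj⟩ := j
  have hij' : i ≤ j := hij
  induction j, hij' using Nat.le_induction with
  | base => simp
  | succ j hij' ih =>
    have h1 := ih (by omega) (Fin.mk_le_mk.2 hij')
    have h2 : f ⟨j + 1, hj⟩ < f ⟨j, by omega⟩ := hf (Fin.mk_lt_mk.2 j.lt_succ_self)
    simp only at h1 ⊢
    omega

/-- The diagram with Frobenius coordinates `(f | g)`. -/
def ofFrobenius {d : ℕ} (f g : Fin d → ℕ) (hf : StrictAnti f) (hg : StrictAnti g) :
    YoungDiagram where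
  cells := (Finset.univ.biUnion fun i : Fin d =>
      (Finset.range (f i + 1)).image fun a => ((i : ℕ), (i : ℕ) + a)) ∪
    Finset.univ.biUnion fun j : Fin d =>
      (Finset.range (g j + 1)).image fun a => ((j : ℕ) + a, (j : ℕ))
  isLowerSet := by
    rintro ⟨i, j⟩ ⟨i', j'⟩ ⟨hi, hj⟩ h
    simp only [Finset.coe_union, Finset.coe_biUnion, Finset.mem_coe, Finset.mem_univ,
      Set.iUnion_true, Finset.coe_image, Set.mem_union, Set.mem_iUnion, Set.mem_image,
      Finset.mem_range, Prod.mk.injEq] at h ⊢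
    simp only at hi hj
    rcases h with ⟨k, a, ha, rfl, rfl⟩ | ⟨k, a, ha, rfl, rfl⟩
    · rcases le_or_gt i' j' with hij | hij
      · have h1 := strictAnti_add_le hf (i := ⟨i', by omega⟩) (j := k) hi
        refine Or.inl ⟨⟨i', by omega⟩, j' - i', ?_, rfl, ?_⟩
        · simp only at h1
          omega
        · simp only
          omega
      · have h1 := strictAnti_add_le hg (i := ⟨j', by omega⟩) (j := ⟨i', by omega⟩) hij.le
        refine Or.inr ⟨⟨j', by omega⟩, i' - j', ?_, ?_, rfl⟩
        · simp only at h1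
          omega
        · simp only
          omega
    · rcases le_or_gt j' i' with hij | hij
      · have h1 := strictAnti_add_le hg (i := ⟨j', by omega⟩) (j := k) hj
        refine Or.inr ⟨⟨j', by omega⟩, i' - j', ?_, ?_, rfl⟩
        · simp only at h1
          omega
        · simp only
          omega
      · have h1 := strictAnti_add_le hf (i := ⟨i', by omega⟩) (j := ⟨j', by omega⟩) hij.le
        refine Or.inl ⟨⟨i', by omega⟩, j' - i', ?_, rfl, ?_⟩
        · simp only at h1
          omega
        · simp only
          omega

section ofFrobenius

variable {d : ℕ} {f g : Fin d → ℕ} (hf : StrictAnti f) (hg : StrictAnti g)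

theorem mem_ofFrobenius {i j : ℕ} : (i, j) ∈ ofFrobenius f g hf hg ↔
    (∃ k : Fin d, (k : ℕ) = i ∧ i ≤ j ∧ j ≤ i + f k) ∨
      ∃ k : Fin d, (k : ℕ) = j ∧ j ≤ i ∧ i ≤ j + g k := by
  rw [← YoungDiagram.mem_cells]
  simp only [ofFrobenius, Finset.mem_union, Finset.mem_biUnion, Finset.mem_univ, true_and,
    Finset.mem_image, Finset.mem_range, Prod.mk.injEq]
  constructor
  · rintro (⟨k, a, ha, rfl, rfl⟩ | ⟨k, a, ha, rfl, rfl⟩)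
    · exact Or.inl ⟨k, rfl, by omega, by omega⟩
    · exact Or.inr ⟨k, rfl, by omega, by omega⟩
  · rintro (⟨k, rfl, h1, h2⟩ | ⟨k, rfl, h1, h2⟩)
    · exact Or.inl ⟨k, j - k, by omega, rfl, by omega⟩
    · exact Or.inr ⟨k, i - k, by omega, by omega, rfl⟩

theorem depth_ofFrobenius : depth (ofFrobenius f g hf hg) = d := by
  refine eq_of_forall_lt_iff fun i => ?_
  rw [lt_depth_iff, mem_ofFrobenius]
  constructor
  · rintro (⟨k, rfl, -⟩ | ⟨k, rfl, -⟩) <;> exact k.2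
  · intro hi
    exact Or.inl ⟨⟨i, hi⟩, rfl, le_rfl, by omega⟩

theorem frobP_ofFrobenius (k : Fin d) : frobP (ofFrobenius f g hf hg) k = f k := by
  have h1 : (ofFrobenius f g hf hg).rowLen k = k + f k + 1 := by
    refine eq_of_forall_lt_iff fun j => ?_
    rw [← YoungDiagram.mem_iff_lt_rowLen, mem_ofFrobenius]
    constructor
    · rintro (⟨l, hl, h2, h3⟩ | ⟨l, hl, h2, h3⟩)
      · obtain rfl : l = k := Fin.ext hl
        omega
      · omega
    · intro hj
      rcases le_or_gt (k : ℕ) j with h | h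
      · exact Or.inl ⟨k, rfl, h, by omega⟩
      · have h2 := strictAnti_add_le hg (i := ⟨j, by omega⟩) (j := k) h.le
        refine Or.inr ⟨⟨j, by omega⟩, rfl, h.le, ?_⟩
        simp only at h2
        omega
  rw [frobP, h1]
  omega

theorem frobQ_ofFrobenius (k : Fin d) : frobQ (ofFrobenius f g hf hg) k = g k := by
  have h1 : (ofFrobenius f g hf hg).colLen k = k + g k + 1 := by
    refine eq_of_forall_lt_iff fun j => ?_
    rw [← YoungDiagram.mem_iff_lt_colLen, mem_ofFrobenius]
    constructor
    · rintro (⟨l, hl, h2, h3⟩ | ⟨l, hl, h2, h3⟩)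
      · omega
      · obtain rfl : l = k := Fin.ext hl
        omega
    · intro hj
      rcases le_or_gt (k : ℕ) j with h | h
      · exact Or.inr ⟨k, rfl, h, by omega⟩
      · have h2 := strictAnti_add_le hf (i := ⟨j, by omega⟩) (j := k) h.le
        refine Or.inl ⟨⟨j, by omega⟩, rfl, h.le, ?_⟩
        simp only at h2
        omega
  rw [frobQ, h1]
  omega

end ofFrobenius

theorem le_of_frob_le {μ ν : YoungDiagram} (hd : depth ν = depth μ)
    (hp : ∀ i < depth μ, frobP ν i ≤ frobP μ i) (hq : ∀ i < depth μ, frobQ ν i ≤ frobQ μ i) :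
    ν ≤ μ := by
  rintro ⟨i, j⟩ h
  rw [mem_iff_frob, hd] at h
  rw [mem_iff_frob]
  rcases h with ⟨h1, h2, h3⟩ | ⟨h1, h2, h3⟩
  · exact Or.inl ⟨h1, h2, h3.trans (Nat.add_le_add_left (hp i h1) i)⟩
  · exact Or.inr ⟨h1, h2, h3.trans (Nat.add_le_add_left (hq j h1) j)⟩

theorem eq_of_frob_eq {μ ν : YoungDiagram} (hd : depth ν = depth μ)
    (hp : ∀ i < depth μ, frobP ν i = frobP μ i) (hq : ∀ i < depth μ, frobQ ν i = frobQ μ i) :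
    ν = μ :=
  le_antisymm (le_of_frob_le hd (fun i hi => (hp i hi).le) fun i hi => (hq i hi).le)
    (le_of_frob_le hd.symm (fun i hi => (hp i (hd ▸ hi)).ge) fun i hi => (hq i (hd ▸ hi)).ge)

/-! ### The Giambelli formula -/

/-- The enumeration of the natural numbers listing first the Frobenius coordinates `qᵢ`, then the
remaining numbers in increasing order. -/
def frobFun (μ : YoungDiagram) (i : ℕ) : ℕ :=
  if i < depth μ then frobQ μ i else i - μ.rowLen i

/-- Equality fails in opposite directions according to whether the square (i, j) belongs to the
diagram. -/
theorem frobQ_ne_sub_rowLen {μ : YoungDiagram} {i j : ℕ} (hj : j < depth μ) (hi : depth μ ≤ i) :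
    frobQ μ j ≠ i - μ.rowLen i := by
  have h1 := lt_depth_iff_lt_colLen.1 hj
  have h2 : ¬ i < μ.rowLen i := fun h => by
    have := lt_depth_iff_lt_rowLen.2 h
    omega
  unfold frobQ
  by_cases h : (i, j) ∈ μ
  · have h3 := YoungDiagram.mem_iff_lt_rowLen.1 h
    have h4 := YoungDiagram.mem_iff_lt_colLen.1 h
    omega
  · have h3 := mt YoungDiagram.mem_iff_lt_rowLen.2 h
    have h4 := mt YoungDiagram.mem_iff_lt_colLen.2 h
    omega

theorem sub_rowLen_lt {μ : YoungDiagram} {i j : ℕ} (hi : depth μ ≤ i) (hij : i < j) :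
    i - μ.rowLen i < j - μ.rowLen j := by
  have h1 := μ.rowLen_anti i j hij.le
  have h2 : ¬ i < μ.rowLen i := fun h => by
    have := lt_depth_iff_lt_rowLen.2 h
    omega
  omega

theorem frobFun_injective (μ : YoungDiagram) : Function.Injective (frobFun μ) := by
  have key : ∀ i j, i < j → frobFun μ i ≠ frobFun μ j := by
    intro i j hij
    unfold frobFun
    split_ifs with h1 h2 h2
    · exact (frobQ_lt_frobQ hij h2).ne'
    · exact frobQ_ne_sub_rowLen h1 (not_lt.1 h2)
    · omega
    · exact (sub_rowLen_lt (not_lt.1 h1) hij).ne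
  intro i j hij
  rcases lt_trichotomy i j with h | h | h
  · exact absurd hij (key i j h)
  · exact h
  · exact absurd hij.symm (key j i h)

theorem frobFun_lt {μ : YoungDiagram} {n i : ℕ} (hn : μ.colLen 0 ≤ n) (hi : i < n) :
    frobFun μ i < n := by
  unfold frobFun frobQ
  have := μ.colLen_anti 0 i (Nat.zero_le _)
  split_ifs <;> omega

/-- `frobFun` as a permutation of `Fin n`. -/
noncomputable def frobPerm (μ : YoungDiagram) {n : ℕ} (hn : μ.colLen 0 ≤ n) :
    Equiv.Perm (Fin n) :=
  Equiv.ofBijective (fun i => ⟨frobFun μ i, frobFun_lt hn i.2⟩)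
    (Finite.injective_iff_bijective.1 fun _ _ hij =>
      Fin.ext (frobFun_injective μ (congrArg Fin.val hij)))

theorem coe_frobPerm {μ : YoungDiagram} {n : ℕ} (hn : μ.colLen 0 ≤ n) (i : Fin n) :
    (frobPerm μ hn i : ℕ) = frobFun μ i := rfl

/-- Inversions start only at positions i below the depth. Since the qᵢ decrease, every value less
than qᵢ occurs after position i, which gives exactly qᵢ inversions. -/
theorem sign_frobPerm {μ : YoungDiagram} {n : ℕ} (hn : μ.colLen 0 ≤ n) :
    (Equiv.Perm.sign (frobPerm μ hn) : ℤˣ) =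
      ∏ i : Fin n, if (i : ℕ) < depth μ then (-1) ^ frobQ μ i else 1 := by
  rw [Equiv.Perm.sign_eq_prod_prod_Ioi]
  refine Finset.prod_congr rfl fun i _ => ?_
  split_ifs with hi
  · rw [Finset.prod_ite, Finset.prod_const_one, one_mul, Finset.prod_const]
    congr 1
    have h1 : (Finset.Ioi i).filter (fun j => ¬ frobPerm μ hn i < frobPerm μ hn j) =
        (Finset.Iio (frobPerm μ hn i)).map (frobPerm μ hn).symm.toEmbedding := by
      ext j
      rw [Finset.mem_map_equiv, Equiv.symm_symm, Finset.mem_filter, Finset.mem_Ioi, Finset.mem_Iio]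
      constructor
      · rintro ⟨h2, h3⟩
        exact lt_of_le_of_ne (not_lt.1 h3) fun h4 => h2.ne' ((frobPerm μ hn).injective h4)
      · intro h2
        refine ⟨?_, h2.le.not_gt⟩
        by_contra h3
        have h4 : (j : ℕ) ≤ i := not_lt.1 h3
        have h5 : frobFun μ j < frobFun μ i := h2
        rcases h4.lt_or_eq with h6 | h6
        · rw [frobFun, frobFun, if_pos hi, if_pos (h6.trans hi)] at h5
          exact absurd h5 (frobQ_lt_frobQ h6 hi).le.not_gt
        · rw [h6] at h5
          exact lt_irrefl _ h5
    rw [h1, Finset.card_map, Fin.card_Iio, coe_frobPerm, frobFun, if_pos hi]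
  · refine Finset.prod_eq_one fun j hj => ?_
    have hij : (i : ℕ) < j := show i < j from Finset.mem_Ioi.1 hj
    rw [if_pos]
    change frobFun μ i < frobFun μ j
    rw [frobFun, frobFun, if_neg hi, if_neg (by omega)]
    exact sub_rowLen_lt (not_lt.1 hi) hij

/-- A determinant some of whose rows are unit vectors reduces to the remaining rows and columns. -/
theorem det_eq_det_of_one_rows {R : Type*} [CommRing R] {n d : ℕ} (hdn : d ≤ n)
    (N : Matrix (Fin n) (Fin n) R)
    (hN : ∀ i j : Fin n, d ≤ (i : ℕ) → N i j = (1 : Matrix (Fin n) (Fin n) R) i j) :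
    N.det = (N.submatrix (Fin.castLE hdn) (Fin.castLE hdn)).det := by
  rw [Matrix.twoBlockTriangular_det N fun i : Fin n => (i : ℕ) < d]
  · have h3 : Matrix.toSquareBlockProp N (fun i : Fin n => ¬ (i : ℕ) < d) = 1 := by
      ext i j
      rw [Matrix.toSquareBlockProp_def, Matrix.of_apply, hN _ _ (not_lt.1 i.2), Matrix.one_apply,
        Matrix.one_apply]
      simp only [Subtype.ext_iff]
    rw [h3, Matrix.det_one, mul_one]
    let e : Fin d ≃ {i : Fin n // (i : ℕ) < d} :=
      { toFun := fun i => ⟨Fin.castLE hdn i, i.2⟩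
        invFun := fun i => ⟨i.1, i.2⟩
        left_inv := fun i => rfl
        right_inv := fun i => rfl }
    exact (Matrix.det_submatrix_equiv_self e _).symm
  · intro i hi j hj
    rw [hN _ _ (not_lt.1 hi), Matrix.one_apply, if_neg]
    rintro rfl
    exact hi hj

/-- Multiplication by the inverse of the negative rows does not change the determinant, turns the
rows beyond the depth into unit vectors, and turns the others into rows pᵢ of W. Moving the unit
vectors to the diagonal leaves the columns qⱼ; the sign of that permutation is ∏ (-1)^{qⱼ}, which
`signMatrix` supplies. -/
theorem jtDet_eq_det_hookMatrix (g : ℤ → PowerSeries ℂ)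
    (hg : ∀ a, PowerSeries.constantCoeff (g (Int.negSucc a)) = 1) {μ : YoungDiagram} {n d : ℕ}
    (hn : μ.colLen 0 ≤ n) (hd : depth μ = d) (p q : Fin d → Fin n)
    (hp : ∀ i, (p i : ℕ) = frobP μ i) (hq : ∀ i, (q i : ℕ) = frobQ μ i) :
    jtDet g n μ = ((hookMatrix g n).submatrix p q).det := by
  subst hd
  have hdn : depth μ ≤ n := (depth_le_colLen μ).trans hn
  set W := posRows g n * (negRows g n)⁻¹ with hW
  set M : Matrix (Fin n) (Fin n) Lam :=
    Matrix.of fun i j : Fin n => jtEntry g ((μ.rowLen i : ℤ) - ((i : ℕ) + 1)) j with hM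
  have hdet := det_negRows g hg n
  have hunit : IsUnit (negRows g n).det := by rw [hdet]; exact isUnit_one
  set N := M * (negRows g n)⁻¹ with hN
  have h1 : jtDet g n μ = N.det := by
    rw [hN, Matrix.det_mul, Matrix.det_nonsing_inv, hdet, Ring.inverse_one, mul_one]
    rfl
  let emb : Fin (depth μ) → Fin n := Fin.castLE hdn
  have hNpos : ∀ (i : Fin (depth μ)) (j : Fin n), N (emb i) j = W (p i) j := by
    intro i j
    rw [hN, hW, Matrix.mul_apply, Matrix.mul_apply]
    refine Finset.sum_congr rfl fun k _ => ?_
    congr 1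
    rw [hM, Matrix.of_apply, posRows, Matrix.of_apply, hp]
    congr 1
    have h2 := lt_depth_iff_lt_rowLen.1 i.2
    change ((μ.rowLen i : ℤ) - ((i : ℕ) + 1)) = ((μ.rowLen i - (i + 1) : ℕ) : ℤ)
    omega
  have hNneg : ∀ i j : Fin n, depth μ ≤ (i : ℕ) →
      N i j = if frobPerm μ hn i = j then 1 else 0 := by
    intro i j hi
    have h2 : N i j = (negRows g n * (negRows g n)⁻¹) (frobPerm μ hn i) j := by
      rw [hN, Matrix.mul_apply, Matrix.mul_apply]
      refine Finset.sum_congr rfl fun k _ => ?_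
      congr 1
      rw [hM, Matrix.of_apply, negRows, Matrix.of_apply, coe_frobPerm, frobFun, if_neg (by omega)]
      congr 1
      have h3 : ¬ (i : ℕ) < μ.rowLen i := fun h => by
        have := lt_depth_iff_lt_rowLen.2 h
        omega
      rw [Int.negSucc_eq]
      omega
    rw [h2, Matrix.mul_nonsing_inv _ hunit, Matrix.one_apply]
  set σ := frobPerm μ hn with hσ
  set N' := N.submatrix id σ with hN'
  have h2 : N'.det = (Equiv.Perm.sign σ : ℤ) * N.det := by
    rw [hN', Matrix.det_permute']
  have hblock : N'.det = (Matrix.of fun i j : Fin (depth μ) => W (p i) (q j)).det := by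
    rw [det_eq_det_of_one_rows hdn N']
    · refine congrArg Matrix.det (Matrix.ext fun i j => ?_)
      refine (hNpos i (σ (emb j))).trans (congrArg (W (p i)) (Fin.ext ?_))
      rw [hq, hσ, coe_frobPerm]
      change frobFun μ j = _
      rw [frobFun, if_pos j.2]
    · intro i j hi
      rw [hN', Matrix.submatrix_apply, id_eq, hNneg _ _ hi, Matrix.one_apply]
      simp only [EmbeddingLike.apply_eq_iff_eq, hσ]
  have hsign : (((Equiv.Perm.sign σ : ℤˣ) : ℤ) : Lam) =
      ∏ j : Fin (depth μ), (-1 : Lam) ^ (q j : ℕ) := by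
    have h3 : ∏ i : Fin n, (if (i : ℕ) < depth μ then (-1 : ℤˣ) ^ frobQ μ i else 1) =
        ∏ j : Fin (depth μ), (-1 : ℤˣ) ^ frobQ μ j := by
      rw [Fin.prod_univ_eq_prod_range
        (fun i : ℕ => if i < depth μ then (-1 : ℤˣ) ^ frobQ μ i else 1) n,
        Fin.prod_univ_eq_prod_range (fun i : ℕ => (-1 : ℤˣ) ^ frobQ μ i) (depth μ),
        ← Finset.prod_subset (Finset.range_subset_range.2 hdn)]
      · exact Finset.prod_congr rfl fun i hi => if_pos (Finset.mem_range.1 hi)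
      · intro i _ hi
        exact if_neg (by simpa using hi)
    rw [hσ, sign_frobPerm, h3]
    push_cast
    exact Finset.prod_congr rfl fun j _ => by rw [hq]
  have hS : ((hookMatrix g n).submatrix p q).det =
      (∏ j : Fin (depth μ), (-1 : Lam) ^ (q j : ℕ)) *
        (Matrix.of fun i j : Fin (depth μ) => W (p i) (q j)).det := by
    rw [← Matrix.det_mul_row]
    refine congrArg Matrix.det (Matrix.ext fun i j => ?_)
    rw [Matrix.submatrix_apply, hookMatrix, signMatrix, Matrix.mul_diagonal, Matrix.of_apply,
      Matrix.of_apply, mul_comm]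
  rw [hS, ← hblock, h2, ← hsign, ← mul_assoc, ← Int.cast_mul, ← Units.val_mul, Int.units_mul_self,
    Units.val_one, Int.cast_one, one_mul, h1]

/-! ### The expansion of the Frobenius–Schur functions -/

theorem rowLen_le_of_le {μ ν : YoungDiagram} (h : ν ≤ μ) (i : ℕ) : ν.rowLen i ≤ μ.rowLen i := by
  by_contra! h1
  exact lt_irrefl _ (YoungDiagram.mem_iff_lt_rowLen.1 (h (YoungDiagram.mem_iff_lt_rowLen.2 h1)))

theorem colLen_le_of_le {μ ν : YoungDiagram} (h : ν ≤ μ) (i : ℕ) : ν.colLen i ≤ μ.colLen i := by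
  by_contra! h1
  exact lt_irrefl _ (YoungDiagram.mem_iff_lt_colLen.1 (h (YoungDiagram.mem_iff_lt_colLen.2 h1)))

/-- The first `d` Frobenius coordinates `pᵢ`, as elements of `Fin (n + 1)`. -/
def frobPFin (n d : ℕ) (μ : YoungDiagram) (i : Fin d) : Fin (n + 1) := Fin.ofNat (n + 1) (frobP μ i)

/-- The first `d` Frobenius coordinates `qᵢ`, as elements of `Fin (n + 1)`. -/
def frobQFin (n d : ℕ) (μ : YoungDiagram) (i : Fin d) : Fin (n + 1) := Fin.ofNat (n + 1) (frobQ μ i)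

/-- `Fin.ofNat` reduces modulo n + 1; the bound on the first row rules out wrapping. -/
theorem coe_frobPFin {n d : ℕ} {μ : YoungDiagram} (h : μ.rowLen 0 ≤ n) (i : Fin d) :
    (frobPFin n d μ i : ℕ) = frobP μ i := by
  have h1 := μ.rowLen_anti 0 i (Nat.zero_le _)
  exact Nat.mod_eq_of_lt (by unfold frobP; omega)

theorem coe_frobQFin {n d : ℕ} {μ : YoungDiagram} (h : μ.colLen 0 ≤ n) (i : Fin d) :
    (frobQFin n d μ i : ℕ) = frobQ μ i := by
  have h1 := μ.colLen_anti 0 i (Nat.zero_le _)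
  exact Nat.mod_eq_of_lt (by unfold frobQ; omega)

theorem strictAnti_frobPFin {n : ℕ} {μ : YoungDiagram} (h : μ.rowLen 0 ≤ n) :
    StrictAnti (frobPFin n (depth μ) μ) := by
  intro i j hij
  rw [Fin.lt_def, coe_frobPFin h, coe_frobPFin h]
  exact frobP_lt_frobP hij j.2

theorem strictAnti_frobQFin {n : ℕ} {μ : YoungDiagram} (h : μ.colLen 0 ≤ n) :
    StrictAnti (frobQFin n (depth μ) μ) := by
  intro i j hij
  rw [Fin.lt_def, coe_frobQFin h, coe_frobQFin h]
  exact frobQ_lt_frobQ hij j.2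

/-- A minor of the triangular matrix `cMatrix` vanishes unless its column indices are at most its
row indices. -/
theorem le_of_det_cMatrix_ne_zero {n d : ℕ} {p f : Fin d → Fin n} (hp : StrictAnti p)
    (hf : StrictAnti f) (h : ((cMatrix n).submatrix p f).det ≠ 0) (k : Fin d) : f k ≤ p k := by
  by_contra! hk
  refine h (det_eq_zero_of_forall_le _ k fun i j hi hj => ?_)
  have h1 : p i < f j := (hp.antitone hi).trans_lt (hk.trans_le (hf.antitone hj))
  rw [Matrix.submatrix_apply, cMatrix, Matrix.of_apply, c_of_lt h1, map_zero]

theorem det_cMatrix_submatrix {n d : ℕ} (p f : Fin d → Fin n) :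
    ((cMatrix n).submatrix p f).det =
      MvPolynomial.C (Matrix.det (Matrix.of fun i j : Fin d => c (p i) (f j))) := by
  rw [RingHom.map_det]
  rfl

-- Cauchy–Binet applied to both products in C K Cᵀ.
open Classical in
theorem jacobiTrudi_eq_sum_strictAnti {μ : YoungDiagram} {n : ℕ} (hr : μ.rowLen 0 ≤ n)
    (hc : μ.colLen 0 ≤ n) :
    jacobiTrudi μ = ∑ x : (Fin (depth μ) → Fin (n + 1)) × (Fin (depth μ) → Fin (n + 1)) with
        StrictAnti x.1 ∧ StrictAnti x.2,
      ((cMatrix (n + 1)).submatrix (frobPFin n (depth μ) μ) x.1).det *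
        ((cMatrix (n + 1)).submatrix (frobQFin n (depth μ) μ) x.2).det *
        ((hookMatrix (fun _ => 1) (n + 1)).submatrix x.1 x.2).det := by
  rw [jacobiTrudi, ← jtDet_eq_of_le _ constantCoeff_fallingSeries_negSucc (hc.trans n.le_succ),
    jtDet_eq_det_hookMatrix _ constantCoeff_fallingSeries_negSucc (hc.trans n.le_succ) rfl
      (frobPFin n (depth μ) μ) (frobQFin n (depth μ) μ) (coe_frobPFin hr) (coe_frobQFin hc),
    hookMatrix_fallingSeries, Matrix.mul_assoc,
    Matrix.submatrix_mul _ _ _ id _ Function.bijective_id, det_mul_eq_sum_strictAnti,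
    ← Finset.univ_product_univ, Finset.filter_product, Finset.sum_product]
  refine Finset.sum_congr rfl fun f _ => ?_
  rw [Matrix.submatrix_submatrix, Matrix.submatrix_submatrix, Function.comp_id, Function.comp_id,
    Matrix.submatrix_mul _ _ _ id _ Function.bijective_id,
    det_mul_eq_sum_strictAnti, Finset.mul_sum]
  refine Finset.sum_congr rfl fun g _ => ?_
  rw [Matrix.submatrix_submatrix, Matrix.submatrix_submatrix, Function.comp_id, Function.comp_id,
    ← Matrix.transpose_submatrix, Matrix.det_transpose, ← mul_assoc]
  exact mul_right_comm _ _ _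

theorem mem_subdiagrams {μ ν : YoungDiagram} : ν ∈ subdiagrams μ ↔ ν ≤ μ ∧ depth ν = depth μ := by
  rw [subdiagrams, Set.Finite.mem_toFinset]
  rfl

theorem jacobiTrudi_eq_sum_schur (μ : YoungDiagram) :
    jacobiTrudi μ = ∑ ν ∈ subdiagrams μ, cDiag μ ν • schur ν := by
  classical
  -- One order n + 1 serves μ and all its subdiagrams; the successor keeps the index type nonempty.
  set n := max (μ.rowLen 0) (μ.colLen 0) with hn
  have hr : μ.rowLen 0 ≤ n := le_max_left _ _
  have hc : μ.colLen 0 ≤ n := le_max_right _ _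
  have hr' : ∀ ν ∈ subdiagrams μ, ν.rowLen 0 ≤ n := fun ν hν =>
    (rowLen_le_of_le (mem_subdiagrams.1 hν).1 0).trans hr
  have hc' : ∀ ν ∈ subdiagrams μ, ν.colLen 0 ≤ n := fun ν hν =>
    (colLen_le_of_le (mem_subdiagrams.1 hν).1 0).trans hc
  rw [jacobiTrudi_eq_sum_strictAnti hr hc]
  symm
  refine Finset.sum_of_injOn
    (fun ν => (frobPFin n (depth μ) ν, frobQFin n (depth μ) ν)) ?_ ?_ ?_ ?_
  · intro ν hν ν' hν' h
    have hd := (mem_subdiagrams.1 hν).2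
    have hd' := (mem_subdiagrams.1 hν').2
    have h1 := congrArg Prod.fst h
    have h2 := congrArg Prod.snd h
    refine eq_of_frob_eq (hd.trans hd'.symm) (fun i hi => ?_) fun i hi => ?_
    · have h3 := congrArg Fin.val (congrFun h1 ⟨i, hd' ▸ hi⟩)
      simpa only [coe_frobPFin (hr' ν hν), coe_frobPFin (hr' ν' hν')] using h3
    · have h3 := congrArg Fin.val (congrFun h2 ⟨i, hd' ▸ hi⟩)
      simpa only [coe_frobQFin (hc' ν hν), coe_frobQFin (hc' ν' hν')] using h3
  · intro ν hν
    have hd := (mem_subdiagrams.1 hν).2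
    have h1 := strictAnti_frobPFin (hr' ν hν)
    have h2 := strictAnti_frobQFin (hc' ν hν)
    rw [hd] at h1 h2
    simp [h1, h2]
  · rintro ⟨f, g⟩ hfg hnot
    obtain ⟨hf, hg⟩ : StrictAnti f ∧ StrictAnti g := by simpa using hfg
    by_contra h
    have hpf := le_of_det_cMatrix_ne_zero (strictAnti_frobPFin hr) hf
      (left_ne_zero_of_mul (left_ne_zero_of_mul h))
    have hqg := le_of_det_cMatrix_ne_zero (strictAnti_frobQFin hc) hg
      (right_ne_zero_of_mul (left_ne_zero_of_mul h))
    have hf' : StrictAnti fun i => (f i : ℕ) := fun i j hij => hf hij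
    have hg' : StrictAnti fun i => (g i : ℕ) := fun i j hij => hg hij
    -- A nonzero term has f ≤ p and g ≤ q, so the diagram (f | g) lies in μ and the term is already
    -- accounted for.
    set ν := ofFrobenius _ _ hf' hg' with hν
    have hd : depth ν = depth μ := depth_ofFrobenius hf' hg'
    have hP : ∀ i : Fin (depth μ), frobP ν i = f i := frobP_ofFrobenius hf' hg'
    have hQ : ∀ i : Fin (depth μ), frobQ ν i = g i := frobQ_ofFrobenius hf' hg'
    have hmem : ν ∈ subdiagrams μ := by
      refine mem_subdiagrams.2 ⟨le_of_frob_le hd (fun i hi => ?_) fun i hi => ?_, hd⟩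
      · have h1 := hpf ⟨i, hi⟩
        rw [Fin.le_def, coe_frobPFin hr, ← hP] at h1
        exact h1
      · have h1 := hqg ⟨i, hi⟩
        rw [Fin.le_def, coe_frobQFin hc, ← hQ] at h1
        exact h1
    refine hnot ⟨ν, hmem, Prod.ext (funext fun i => Fin.ext ?_) (funext fun i => Fin.ext ?_)⟩
    · exact (coe_frobPFin (hr' ν hmem) i).trans (hP i)
    · exact (coe_frobQFin (hc' ν hmem) i).trans (hQ i)
  · intro ν hν
    have hd := (mem_subdiagrams.1 hν).2
    have hcν := (hc' ν hν).trans n.le_succ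
    rw [det_cMatrix_submatrix, det_cMatrix_submatrix, ← MvPolynomial.C_mul, schur_eq_jtDet,
      ← jtDet_eq_of_le _ (fun _ => map_one _) hcν,
      jtDet_eq_det_hookMatrix _ (fun _ => map_one _) hcν hd _ _
        (coe_frobPFin (hr' ν hν)) (coe_frobQFin (hc' ν hν)), MvPolynomial.smul_eq_C_mul, cDiag]
    simp only [coe_frobPFin hr, coe_frobQFin hc, coe_frobPFin (hr' ν hν),
      coe_frobQFin (hc' ν hν)]

end FrobeniusSchur

/-- The first two clauses say that the shifted Schur functions and the isomorphism `φ`, through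
which `Fs` is defined, exist and are unique. -/
theorem theorem2p6 :
    (∀ μ : YoungDiagram, ∃! f : FrobeniusSchur.LamStar, FrobeniusSchur.IsShiftedSchur μ f) ∧
    (∃! φ : FrobeniusSchur.LamStar →ₐ[ℂ] FrobeniusSchur.Lam, FrobeniusSchur.IsPhi φ) ∧
    ∀ μ : YoungDiagram,
      FrobeniusSchur.Fs μ =
        ∑ ν ∈ FrobeniusSchur.subdiagrams μ,
          FrobeniusSchur.cDiag μ ν • FrobeniusSchur.schur ν :=
  ⟨FrobeniusSchur.existsUnique_isShiftedSchur, FrobeniusSchur.existsUnique_isPhi, fun μ =>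
    (FrobeniusSchur.Fs_eq_jacobiTrudi μ).trans (FrobeniusSchur.jacobiTrudi_eq_sum_schur μ)⟩
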